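/- Let $n,m,N,T\ge 1$ be integers ($m=0$ is allowed), $A\in\mathbb{R}^{n\times n}$, $B\in\mathbb{R}^{n\times m}$, and consider the system $x(t+1)=Ax(t)+Bu(t)+w(t)$, $x(0)=0$, with state $x(t)\in\mathbb{R}^n$, input $u(t)\in\mathbb{R}^m$ and noise $w(t)\in\mathbb{R}^n$, whose parameter matrix $\Theta^\ast=[A,B]^{\mathsf T}\in\mathbb{R}^{(n+m)\times n}$ has rank $r<n$. Call a zero-mean random vector $y\in\mathbb{R}^d$ sub-Gaussian with parameter $\sigma>0$ if $\mathbb{E}\,e^{s\langle v,y\rangle}\le e^{s^2\sigma^2/2}$ for all unit vectors $v\in\mathbb{R}^d$ and all $s\in\mathbb{R}$. Let $N$ mutually independent sample sets $(x^{(i)},u^{(i)},w^{(i)})$, $i=1,\dots,N$, of the system over the times $0,\dots,T$ be given. In each of them the noise vectors $w^{(i)}(0),\dots,w^{(i)}(T-1)$ are independent, sub-Gaussian with parameter $\sigma_w$, and jointly independent of the inputs $u^{(i)}(0),\dots,u^{(i)}(T-1)$. Let $X\in\mathbb{R}^{N\times n}$ have the rows $x^{(i)}(T)^{\mathsf T}$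 and $Z\in\mathbb{R}^{N\times(n+m)}$ the rows $z^{(i)}(T-1)^{\mathsf T}$, where $z^{(i)}(t)$ is the vector obtained by stacking $x^{(i)}(t)$ and $u^{(i)}(t)$. Assume that all $z^{(i)}(T-1)$ are sub-Gaussian with parameter $\beta$ and have the same covariance matrix $\Sigma$, with largest and smallest singular values $\gamma_{\max}(\Sigma)$ and $\gamma_{\min}(\Sigma)>0$. Let $\alpha\ge 0$ be given by $\alpha^2=2\sigma_w^2\big[(32\sqrt6+1)\beta^2+\gamma_{\max}(\Sigma)\big]$. There are absolute constants $c_1,c_5,c_6>0$ such that whenever $$N\ge\frac{c_1\beta^4}{\gamma_{\min}(\Sigma)^2}(n+m)\qquad\text{and}\qquad \lambda_N=4\alpha\sqrt{\frac{n+m}{N}},$$ then, with probability at least $1-c_5e^{-c_6(n+m)}$, the program $$\min_{\Theta\in\mathbb{R}^{(n+m)\times n}}\ \frac1{2N}\|X-Z\Theta\|_{\mathrm F}^2+\lambda_N\|\Theta\|_{\mathrm{nuc}}$$ ($\|\cdot\|_{\mathrm{nuc}}$ being the sum of the singular values) has a solution, and every solution $\widehat\Theta$ of it satisfies $$\|\widehat\Theta-\Theta^\ast\|_{\mathrm{op}}\le\frac{12\alpha}{\gamma_{\min}(\Sigma)}\sqrt{\frac{n+m}{N}}.$$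 -/

import Mathlib

open MeasureTheory ProbabilityTheory

noncomputable section

namespace VARX

/-! ### Matrix norms and singular values -/

section Norms

variable {ι κ : Type*} [Fintype ι] [Fintype κ]

/-- The Frobenius norm `√(trace (MᵀM))`. -/
def frobNorm (M : Matrix ι κ ℝ) : ℝ :=
  Real.sqrt (M.transpose * M).trace

variable [DecidableEq κ]

/-- The singular values of a real matrix in decreasing order, indexed from `0`. -/
def singularValue (M : Matrix ι κ ℝ) (k : ℕ) : ℝ :=
  (Matrix.toEuclideanLin M).singularValues k

/-- The operator norm of a real matrix with respect to the Euclidean norms. -/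
def opNorm (M : Matrix ι κ ℝ) : ℝ :=
  ‖(Matrix.toEuclideanLin M).toContinuousLinearMap‖

/-- The nuclear norm: the sum of all singular values. -/
def nuclearNorm (M : Matrix ι κ ℝ) : ℝ :=
  ∑ k ∈ Finset.range (min (Fintype.card ι) (Fintype.card κ)), singularValue M k

/-- The largest singular value of a square matrix. -/
def gammaMax (S : Matrix κ κ ℝ) : ℝ := singularValue S 0

/-- The smallest singular value of a (nonempty) square matrix. -/
def gammaMin (S : Matrix κ κ ℝ) : ℝ := singularValue S (Fintype.card κ - 1)

end Norms

/-! ### Random vectors -/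

section RandomVectors

variable {Ω ι : Type*} [MeasurableSpace Ω] [Fintype ι]

/-- A zero-mean random vector is sub-Gaussian with parameter `σ > 0` if
`𝔼 exp (l ⟨v, X⟩) ≤ exp (l² σ² / 2)` for all unit vectors `v` and all real `l`. -/
structure IsSubGaussianVec (X : Ω → EuclideanSpace ℝ ι) (σ : ℝ) (μ : Measure Ω) : Prop where
  param_pos : 0 < σ
  mean_zero : ∫ ω, X ω ∂μ = 0
  subgaussian : ∀ v : EuclideanSpace ℝ ι, ‖v‖ = 1 →
    HasSubgaussianMGF (fun ω => inner ℝ v (X ω)) (Real.toNNReal (σ ^ 2)) μ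

/-- The covariance matrix of a random vector. -/
def covMatrix (X : Ω → EuclideanSpace ℝ ι) (μ : Measure Ω) : Matrix ι ι ℝ :=
  Matrix.of fun j k => covariance (fun ω => X ω j) (fun ω => X ω k) μ

end RandomVectors

/-! ### The system, the data and the estimator -/

section System

variable {Ω : Type*} {n m N : ℕ}

/-- The parameter matrix `[A, B]ᵀ`. -/
def paramMatrix (A : Matrix (Fin n) (Fin n) ℝ) (B : Matrix (Fin n) (Fin m) ℝ) :
    Matrix (Fin n ⊕ Fin m) (Fin n) ℝ :=
  (Matrix.fromCols A B).transpose

/-- The vector `z = (x, u)` obtained by stacking a state and an input. -/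
def stack (x : EuclideanSpace ℝ (Fin n)) (u : EuclideanSpace ℝ (Fin m)) :
    EuclideanSpace ℝ (Fin n ⊕ Fin m) :=
  WithLp.toLp 2 (Sum.elim (fun j => x j) (fun j => u j))

/-- `N` independently collected sample sets over the times `0, …, T` of the system
`x(t+1) = A x(t) + B u(t) + w(t)`, `x(0) = 0`. In every sample set the noise vectors
`w(0), …, w(T-1)` are independent, and the noise is independent of the input. -/
structure IsSampledSystem [MeasurableSpace Ω] (μ : Measure Ω)
    (A : Matrix (Fin n) (Fin n) ℝ) (B : Matrix (Fin n) (Fin m) ℝ) (T : ℕ)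
    (x : Fin N → ℕ → Ω → EuclideanSpace ℝ (Fin n))
    (u : Fin N → ℕ → Ω → EuclideanSpace ℝ (Fin m))
    (w : Fin N → ℕ → Ω → EuclideanSpace ℝ (Fin n)) : Prop where
  measurable_input : ∀ i, ∀ t < T, Measurable (u i t)
  measurable_noise : ∀ i, ∀ t < T, Measurable (w i t)
  init : ∀ i ω, x i 0 ω = 0
  dynamics : ∀ i, ∀ t < T, ∀ ω, x i (t + 1) ω =
    Matrix.toEuclideanLin A (x i t ω) + Matrix.toEuclideanLin B (u i t ω) + w i t ω
  indep_samples : iIndepFun (fun i ω (t : Fin T) => (u i t ω, w i t ω)) μ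
  indep_noise : ∀ i, iIndepFun (fun (t : Fin T) ω => w i t ω) μ
  indep_input_noise : ∀ i,
    IndepFun (fun ω (t : Fin T) => u i t ω) (fun ω (t : Fin T) => w i t ω) μ

/-- The response matrix `X`, whose rows are the final states `x⁽ⁱ⁾(T)`. -/
def responseMatrix (T : ℕ) (x : Fin N → ℕ → Ω → EuclideanSpace ℝ (Fin n)) (ω : Ω) :
    Matrix (Fin N) (Fin n) ℝ :=
  Matrix.of fun i j => x i T ω j

/-- The random vector `z⁽ⁱ⁾(T-1)`, that is, the `i`-th row of the measurement matrix `Z`. -/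
def measurementRow (T : ℕ) (x : Fin N → ℕ → Ω → EuclideanSpace ℝ (Fin n))
    (u : Fin N → ℕ → Ω → EuclideanSpace ℝ (Fin m)) (i : Fin N) (ω : Ω) :
    EuclideanSpace ℝ (Fin n ⊕ Fin m) :=
  stack (x i (T - 1) ω) (u i (T - 1) ω)

/-- The measurement matrix `Z`, whose rows are `z⁽ⁱ⁾(T-1)`. -/
def measurementMatrix (T : ℕ) (x : Fin N → ℕ → Ω → EuclideanSpace ℝ (Fin n))
    (u : Fin N → ℕ → Ω → EuclideanSpace ℝ (Fin m)) (ω : Ω) :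
    Matrix (Fin N) (Fin n ⊕ Fin m) ℝ :=
  Matrix.of fun i j => measurementRow T x u i ω j

/-- The nuclear-norm regularized least squares objective
`‖X - Z Θ‖_F² / (2N) + lam ‖Θ‖_nuc`. -/
def objective (X : Matrix (Fin N) (Fin n) ℝ) (Z : Matrix (Fin N) (Fin n ⊕ Fin m) ℝ) (lam : ℝ)
    (Θ : Matrix (Fin n ⊕ Fin m) (Fin n) ℝ) : ℝ :=
  1 / (2 * (N : ℝ)) * frobNorm (X - Z * Θ) ^ 2 + lam * nuclearNorm Θ

/-- `Θ` solves the regularized program: it is a global minimizer of the objective. -/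
def IsSolution (X : Matrix (Fin N) (Fin n) ℝ) (Z : Matrix (Fin N) (Fin n ⊕ Fin m) ℝ) (lam : ℝ)
    (Θ : Matrix (Fin n ⊕ Fin m) (Fin n) ℝ) : Prop :=
  ∀ Θ' : Matrix (Fin n ⊕ Fin m) (Fin n) ℝ, objective X Z lam Θ ≤ objective X Z lam Θ'

end System

end VARX

end

/-!
# Operator norm error of nuclear-norm regularized system identification

Write `zᵢ` for the regressors `z⁽ⁱ⁾(T-1)`, `wᵢ` for the last noise vectors, `W` for the matrix with
rows `wᵢ`, `d = n + m` and `γ = γ_min(Σ)`. The final states satisfy `X = Z Θ* + W`.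

*Deterministic part.* At a solution `Θ`, optimality along rank-one perturbations says that the
gradient `Zᵀ(X - ZΘ)/N` of the quadratic loss has operator norm at most `λ`, because adding `p qᵀ`
raises the nuclear norm by at most `‖p‖ ‖q‖` (duality with the operator norm,
`exists_contraction_trace_eq` and `trace_adjoint_comp_le`). Hence `(ZᵀZ/N)(Θ - Θ*)` has operator
norm at most `λ + ‖ZᵀW/N‖`. If `‖ZᵀZ/N - Σ‖ ≤ γ/6` and `‖ZᵀW/N‖ ≤ 6 α √(d/N)`, then the error is at
most `(4 + 6) α √(d/N) / (5γ/6) = 12 α √(d/N) / γ` (`IsSampledSystem.solution_bound`). A solution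
exists because `Z` is then injective and the objective coercive.

*Probabilistic part.* Both deviations are instances of one statement,
`measure_not_norm_sum_sub_le`, on the empirical cross-covariance of two sub-Gaussian vectors: at
fixed test vectors the summands are products of sub-Gaussian variables, whose moment generating
function is controlled near `0` with an explicit constant (`mgf_mul_le`), and `1/2`-nets with `5^d`
points turn this into an operator norm bound. The cross-covariance of `zᵢ` and `wᵢ` vanishes, since
`zᵢ` depends only on the inputs and on the earlier noise (`IsSampledSystem.indepFun_row_noise`).
-/

namespace VARX

/-! ### Products of sub-Gaussian variables -/

section SubGaussianProducts

variable {Ω : Type*} [MeasurableSpace Ω] {μ : Measure Ω}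

/-- A linear-plus-quadratic bound on `exp` whose error term is a multiple of an exponential of
small rate, so that it is integrable for products of sub-Gaussian variables. -/
lemma exp_mul_le_of_abs_le {s x : ℝ} (hs : |s| ≤ 1 / 8) :
    Real.exp (s * x) ≤ 1 + s * x + 9 * s ^ 2 * Real.exp (3 / 8 * |x|) := by
  have h1 : Real.exp (s * x) ≤ 1 + s * x + |s * x| ^ 2 * Real.exp |s * x| := by
    have h := Complex.norm_exp_sub_sum_le_norm_mul_exp ((s * x : ℝ) : ℂ) 2
    have h2 : Complex.exp ((s * x : ℝ) : ℂ) - ∑ m ∈ Finset.range 2,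
        ((s * x : ℝ) : ℂ) ^ m / (m.factorial : ℂ) = ((Real.exp (s * x) - (1 + s * x) : ℝ) : ℂ) := by
      simp [Finset.sum_range_succ]
    rw [h2, Complex.norm_real, Complex.norm_real, Real.norm_eq_abs, Real.norm_eq_abs] at h
    linarith [le_abs_self (Real.exp (s * x) - (1 + s * x))]
  have h3 : |x| ^ 2 ≤ 9 * Real.exp (|x| / 4) := by
    -- `y + 1 ≤ exp y` at `y = |x| / 8 - 1` is the sharp linear bound
    have h4 : |x| / 8 * Real.exp 1 ≤ Real.exp (|x| / 8) := by
      have := Real.add_one_le_exp (|x| / 8 - 1)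
      rw [Real.exp_sub, le_div_iff₀ (Real.exp_pos 1)] at this
      linarith
    have h5 : |x| ≤ 3 * Real.exp (|x| / 8) := by
      have := Real.exp_one_gt_d9
      nlinarith [abs_nonneg x]
    have h6 : Real.exp (|x| / 4) = Real.exp (|x| / 8) ^ 2 := by
      rw [← Real.exp_nat_mul]; congr 1; push_cast; ring
    rw [h6]
    nlinarith [abs_nonneg x, Real.exp_pos (|x| / 8)]
  have h7 : Real.exp |s * x| ≤ Real.exp (|x| / 8) := by
    rw [Real.exp_le_exp, abs_mul]
    nlinarith [abs_nonneg x]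
  have h8 : Real.exp (3 / 8 * |x|) = Real.exp (|x| / 4) * Real.exp (|x| / 8) := by
    rw [← Real.exp_add]; congr 1; ring
  have h9 : |s * x| ^ 2 * Real.exp |s * x| ≤ s ^ 2 * (9 * Real.exp (|x| / 4)) *
      Real.exp (|x| / 8) := by
    rw [abs_mul, mul_pow, sq_abs s, ← abs_mul]
    gcongr
  rw [h8]
  linarith

lemma integral_exp_sq_gaussianReal :
    Integrable (fun y : ℝ => Real.exp (3 / 8 * y ^ 2)) (gaussianReal 0 1) ∧
      ∫ y : ℝ, Real.exp (3 / 8 * y ^ 2) ∂gaussianReal 0 1 = 2 := by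
  have h : ∀ y : ℝ, gaussianPDFReal 0 1 y • Real.exp (3 / 8 * y ^ 2) =
      (√(2 * Real.pi))⁻¹ * Real.exp (-(1 / 8) * y ^ 2) := by
    intro y
    rw [gaussianPDFReal, smul_eq_mul, mul_assoc, ← Real.exp_add]
    simp only [NNReal.coe_one, mul_one, sub_zero]
    congr 2; ring
  constructor
  · rw [gaussianReal_of_var_ne_zero _ one_ne_zero]
    rw [integrable_withDensity_iff_integrable_smul₀' (by fun_prop)
      (by simp [gaussianPDF_lt_top])]
    simp only [toReal_gaussianPDF, h]
    exact (integrable_exp_neg_mul_sq (by norm_num)).const_mul _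
  · rw [integral_gaussianReal_eq_integral_smul one_ne_zero]
    simp only [h]
    rw [integral_const_mul, integral_gaussian, ← Real.sqrt_inv, ← Real.sqrt_mul (by positivity)]
    rw [show (2 * Real.pi)⁻¹ * (Real.pi / (1 / 8)) = 2 ^ 2 by field_simp; norm_num]
    exact Real.sqrt_sq (by norm_num)

/-- The square of a sub-Gaussian variable has an exponential moment. The square in the exponent is
linearized by averaging over an auxiliary Gaussian variable. -/
lemma lintegral_exp_sq_le [SFinite μ] {X : Ω → ℝ} (hX : HasSubgaussianMGF X 1 μ) :
    ∫⁻ ω, ENNReal.ofReal (Real.exp (3 / 8 * X ω ^ 2)) ∂μ ≤ 2 := by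
  have h1 : ∀ a : ℝ, ENNReal.ofReal (Real.exp (3 / 8 * a ^ 2)) =
      ∫⁻ y, ENNReal.ofReal (Real.exp (√(3 / 4) * a * y)) ∂gaussianReal 0 1 := by
    intro a
    rw [← ofReal_integral_eq_lintegral_ofReal (integrable_exp_mul_gaussianReal _)
      (Filter.Eventually.of_forall fun y => (Real.exp_pos _).le)]
    congr 1
    have h := congrFun (mgf_id_gaussianReal (μ := 0) (v := 1)) (√(3 / 4) * a)
    simp only [mgf, id] at h
    rw [h]
    congr 1
    rw [mul_pow, Real.sq_sqrt (by norm_num)]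
    push_cast; ring
  simp_rw [h1]
  have hm := hX.aemeasurable
  rw [lintegral_lintegral_swap]
  · calc ∫⁻ y, ∫⁻ ω, ENNReal.ofReal (Real.exp (√(3 / 4) * X ω * y)) ∂μ ∂gaussianReal 0 1
        ≤ ∫⁻ y, ENNReal.ofReal (Real.exp (3 / 8 * y ^ 2)) ∂gaussianReal 0 1 := by
          refine lintegral_mono fun y => ?_
          have h2 : ∀ ω, √(3 / 4) * X ω * y = (√(3 / 4) * y) * X ω := fun ω => by ring
          simp_rw [h2]
          rw [← ofReal_integral_eq_lintegral_ofReal (hX.integrable_exp_mul _)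
            (Filter.Eventually.of_forall fun y => (Real.exp_pos _).le)]
          refine ENNReal.ofReal_le_ofReal ((hX.mgf_le _).trans_eq ?_)
          congr 1
          rw [mul_pow, Real.sq_sqrt (by norm_num)]
          push_cast; ring
      _ = 2 := by
          rw [← ofReal_integral_eq_lintegral_ofReal integral_exp_sq_gaussianReal.1
            (Filter.Eventually.of_forall fun y => (Real.exp_pos _).le),
            integral_exp_sq_gaussianReal.2]
          simp
  · have : AEMeasurable (fun p : Ω × ℝ => X p.1) (μ.prod (gaussianReal 0 1)) := hm.comp_fst
    simp only [Function.uncurry_def]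
    fun_prop

lemma integrable_exp_sq [SFinite μ] {X : Ω → ℝ} (hX : HasSubgaussianMGF X 1 μ) :
    Integrable (fun ω => Real.exp (3 / 8 * X ω ^ 2)) μ := by
  have hm := hX.aemeasurable
  refine ⟨(by fun_prop : AEMeasurable _ μ).aestronglyMeasurable, ?_⟩
  rw [hasFiniteIntegral_iff_ofReal (Filter.Eventually.of_forall fun y => (Real.exp_pos _).le)]
  exact (lintegral_exp_sq_le hX).trans_lt (by simp)

lemma integral_exp_sq_le [SFinite μ] {X : Ω → ℝ} (hX : HasSubgaussianMGF X 1 μ) :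
    ∫ ω, Real.exp (3 / 8 * X ω ^ 2) ∂μ ≤ 2 := by
  have h := lintegral_exp_sq_le hX
  rw [← ofReal_integral_eq_lintegral_ofReal (integrable_exp_sq hX)
    (Filter.Eventually.of_forall fun y => (Real.exp_pos _).le)] at h
  rwa [ENNReal.ofReal_le_iff_le_toReal (by simp)] at h

lemma integral_sq_le [IsProbabilityMeasure μ] {X : Ω → ℝ} (hX : HasSubgaussianMGF X 1 μ) :
    ∫ ω, X ω ^ 2 ∂μ ≤ 8 / 3 := by
  have h1 : ∫ ω, (3 / 8 * X ω ^ 2 + 1) ∂μ ≤ ∫ ω, Real.exp (3 / 8 * X ω ^ 2) ∂μ :=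
    integral_mono (((hX.memLp 2).integrable_sq.const_mul _).add (integrable_const _))
      (integrable_exp_sq hX) fun ω => Real.add_one_le_exp _
  rw [integral_add ((hX.memLp 2).integrable_sq.const_mul _) (integrable_const _),
    integral_const_mul] at h1
  have := integral_exp_sq_le hX
  simp at h1
  linarith

lemma exp_abs_mul_le (a b : ℝ) :
    Real.exp (3 / 8 * |a * b|) ≤
      (Real.exp (3 / 8 * a ^ 2) + Real.exp (3 / 8 * b ^ 2)) / 2 := by
  have h1 : Real.exp (3 / 8 * |a * b|) ≤
      Real.exp (3 / 16 * a ^ 2) * Real.exp (3 / 16 * b ^ 2) := by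
    rw [← Real.exp_add, Real.exp_le_exp, abs_mul]
    nlinarith [sq_nonneg (|a| - |b|), sq_abs a, sq_abs b]
  have h2 : ∀ c : ℝ, Real.exp (3 / 8 * c ^ 2) = Real.exp (3 / 16 * c ^ 2) ^ 2 := by
    intro c
    rw [← Real.exp_nat_mul]; congr 1; push_cast; ring
  rw [h2 a, h2 b]
  nlinarith [sq_nonneg (Real.exp (3 / 16 * a ^ 2) - Real.exp (3 / 16 * b ^ 2))]

lemma integrable_mul_of_subgaussian [IsFiniteMeasure μ] {X Y : Ω → ℝ} {c d : NNReal}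
    (hX : HasSubgaussianMGF X c μ) (hY : HasSubgaussianMGF Y d μ) :
    Integrable (fun ω => X ω * Y ω) μ :=
  MemLp.integrable_mul (p := 2) (q := 2) (hX.memLp 2) (hY.memLp 2)

/-- The product of two sub-Gaussian variables, however dependent, is sub-exponential. -/
lemma mgf_mul_le [IsProbabilityMeasure μ] {X Y : Ω → ℝ} (hX : HasSubgaussianMGF X 1 μ)
    (hY : HasSubgaussianMGF Y 1 μ) {s : ℝ} (hs : |s| ≤ 1 / 8) :
    Integrable (fun ω => Real.exp (s * (X ω * Y ω))) μ ∧
      mgf (fun ω => X ω * Y ω) μ s ≤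
        Real.exp (s * ∫ ω, X ω * Y ω ∂μ + 18 * s ^ 2) := by
  have hXY := integrable_mul_of_subgaussian hX hY
  have hm := hXY.aemeasurable
  set f : Ω → ℝ := fun ω => 1 + s * (X ω * Y ω) + 9 * s ^ 2 *
    ((Real.exp (3 / 8 * X ω ^ 2) + Real.exp (3 / 8 * Y ω ^ 2)) / 2) with hf
  have hfle : ∀ ω, Real.exp (s * (X ω * Y ω)) ≤ f ω := fun ω =>
    (exp_mul_le_of_abs_le hs).trans (by
      have := exp_abs_mul_le (X ω) (Y ω)
      simp only [hf]; gcongr)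
  have hI := (((integrable_exp_sq hX).add (integrable_exp_sq hY)).div_const 2).const_mul
    (9 * s ^ 2)
  have hI1 : Integrable (fun ω => 1 + s * (X ω * Y ω)) μ :=
    (integrable_const _).add (hXY.const_mul s)
  have hfint : Integrable f μ := hI1.add hI
  have hint : Integrable (fun ω => Real.exp (s * (X ω * Y ω))) μ :=
    hfint.mono' (hm.const_mul s).exp.aestronglyMeasurable (Filter.Eventually.of_forall fun ω => by
      rw [Real.norm_eq_abs, abs_of_pos (Real.exp_pos _)]; exact hfle ω)
  refine ⟨hint, (integral_mono hint hfint hfle).trans ?_⟩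
  have : ∫ ω, f ω ∂μ = 1 + s * ∫ ω, X ω * Y ω ∂μ + 9 * s ^ 2 *
      ((∫ ω, Real.exp (3 / 8 * X ω ^ 2) ∂μ + ∫ ω, Real.exp (3 / 8 * Y ω ^ 2) ∂μ) / 2) := by
    simp only [hf]
    rw [integral_add hI1 (by exact hI), integral_add (integrable_const _) (hXY.const_mul s),
      integral_const_mul, integral_const_mul, integral_div,
      integral_add (integrable_exp_sq hX) (integrable_exp_sq hY)]
    simp
  rw [this]
  have hX2 := integral_exp_sq_le hX
  have hY2 := integral_exp_sq_le hY
  have h := Real.add_one_le_exp (s * ∫ ω, X ω * Y ω ∂μ + 18 * s ^ 2)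
  nlinarith [sq_nonneg s]

/-- Bernstein-type bound for the upper tail of an average of independent products of sub-Gaussian
variables. The range of `t` is the one in which the tail is Gaussian. -/
lemma measure_sum_mul_ge_le [IsProbabilityMeasure μ] {N : ℕ} {X Y : Fin N → Ω → ℝ}
    (hX : ∀ i, HasSubgaussianMGF (X i) 1 μ) (hY : ∀ i, HasSubgaussianMGF (Y i) 1 μ)
    (hm : ∀ i, Measurable fun ω => X i ω * Y i ω)
    (hind : iIndepFun (fun i ω => X i ω * Y i ω) μ) {e : ℝ}
    (he : ∀ i, ∫ ω, X i ω * Y i ω ∂μ = e) {t : ℝ} (ht0 : 0 ≤ t) (ht : t ≤ 9 / 2) :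
    μ.real {ω | N * (e + t) ≤ ∑ i, X i ω * Y i ω} ≤ Real.exp (-(N * t ^ 2 / 72)) := by
  -- the exponent `-s t + 18 s ^ 2` is minimal at `s = t / 36`
  have hs : |t / 36| ≤ 1 / 8 := by rw [abs_of_nonneg (by positivity)]; linarith
  have hsum : (∑ i, fun ω => X i ω * Y i ω) = fun ω => ∑ i, X i ω * Y i ω := by
    ext ω; simp
  have hint := hind.integrable_exp_mul_sum (t := t / 36) hm (s := Finset.univ)
    fun i _ => (mgf_mul_le (hX i) (hY i) hs).1
  rw [hsum] at hint
  refine (measure_ge_le_exp_mul_mgf _ (by positivity : 0 ≤ t / 36) hint).trans ?_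
  rw [← hsum, hind.mgf_sum hm]
  calc Real.exp (-(t / 36) * (N * (e + t))) * ∏ i, mgf (fun ω => X i ω * Y i ω) μ (t / 36)
      ≤ Real.exp (-(t / 36) * (N * (e + t))) *
          ∏ i : Fin N, Real.exp (t / 36 * e + 18 * (t / 36) ^ 2) := by
        gcongr with i
        · intro i _; exact mgf_nonneg
        · have := (mgf_mul_le (hX i) (hY i) hs).2
          rwa [he i] at this
    _ = Real.exp (-(N * t ^ 2 / 72)) := by
        rw [Finset.prod_const, Finset.card_univ, Fintype.card_fin, ← Real.exp_nat_mul,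
          ← Real.exp_add]
        congr 1; ring

end SubGaussianProducts

/-! ### Nets of the sphere -/

section Nets

open Module

variable {E F : Type*} [NormedAddCommGroup E] [InnerProductSpace ℝ E]
  [NormedAddCommGroup F] [InnerProductSpace ℝ F]

lemma norm_le_of_net {s : Finset E} (hs : ∀ x : E, ‖x‖ = 1 → ∃ v ∈ s, ‖x - v‖ < 1 / 2)
    {x : E} {c : ℝ} (hc : 0 ≤ c) (h : ∀ v ∈ s, inner ℝ v x ≤ c) : ‖x‖ ≤ 2 * c := by
  rcases eq_or_ne x 0 with rfl | hx
  · simpa using hc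
  have hx' : ‖x‖ ≠ 0 := norm_ne_zero_iff.2 hx
  obtain ⟨v, hv, hxv⟩ := hs (‖x‖⁻¹ • x) (by rw [norm_smul, norm_inv, norm_norm]; field_simp)
  have h1 : inner ℝ (‖x‖⁻¹ • x) x = ‖x‖ := by
    rw [real_inner_smul_left, real_inner_self_eq_norm_sq]; field_simp
  have h2 : inner ℝ (‖x‖⁻¹ • x - v) x ≤ 1 / 2 * ‖x‖ :=
    (real_inner_le_norm _ _).trans (by gcongr)
  rw [inner_sub_left, h1] at h2
  linarith [h v hv]

variable [FiniteDimensional ℝ E] [FiniteDimensional ℝ F]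

variable (E) in
/-- The unit sphere has a `1/2`-net of at most `5 ^ dim E` points. -/
lemma exists_net : ∃ s : Finset E, (∀ v ∈ s, ‖v‖ = 1) ∧ s.card ≤ 5 ^ finrank ℝ E ∧
    ∀ x : E, ‖x‖ = 1 → ∃ v ∈ s, ‖x - v‖ < 1 / 2 := by
  classical
  let P : Finset E → Prop := fun s => (∀ v ∈ s, ‖v‖ = 1) ∧
    ∀ v ∈ s, ∀ w ∈ s, v ≠ w → 1 / 2 ≤ ‖v - w‖
  have hcard : ∀ s, P s → s.card ≤ 5 ^ finrank ℝ E := by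
    intro s hs
    have hinj : Function.Injective fun v : E => (2 : ℝ) • v := smul_right_injective E two_ne_zero
    rw [← Finset.card_image_of_injective s hinj]
    refine Besicovitch.card_le_of_separated _ ?_ ?_
    · intro c hc
      obtain ⟨v, hv, rfl⟩ := Finset.mem_image.1 hc
      simp [norm_smul, hs.1 v hv]
    · intro c hc d hd hcd
      obtain ⟨v, hv, rfl⟩ := Finset.mem_image.1 hc
      obtain ⟨w, hw, rfl⟩ := Finset.mem_image.1 hd
      have h := hs.2 v hv w hw (fun h => hcd (by rw [h]))
      rw [← smul_sub, norm_smul, Real.norm_eq_abs, abs_two]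
      linarith
  let K : Set ℕ := {k | ∃ s, P s ∧ s.card = k}
  have hK : BddAbove K := ⟨5 ^ finrank ℝ E, by rintro k ⟨s, hs, rfl⟩; exact hcard s hs⟩
  obtain ⟨s, hs, hsK⟩ : sSup K ∈ K :=
    Nat.sSup_mem ⟨0, ∅, ⟨by simp, by simp⟩, rfl⟩ hK
  refine ⟨s, hs.1, hcard s hs, fun x hx => ?_⟩
  -- a point far from `s` would extend the separated set `s` of maximal cardinality
  by_contra! hfar
  have hxs : x ∉ s := fun h => by
    have := hfar x h
    norm_num at this
  have hP : P (insert x s) := by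
    refine ⟨fun v hv => ?_, fun v hv w hw hvw => ?_⟩
    · rcases Finset.mem_insert.1 hv with rfl | hv
      exacts [hx, hs.1 v hv]
    · rcases Finset.mem_insert.1 hv with rfl | hv' <;>
        rcases Finset.mem_insert.1 hw with rfl | hw'
      · exact absurd rfl hvw
      · exact hfar w hw'
      · rw [norm_sub_rev]; exact hfar v hv'
      · exact hs.2 v hv' w hw' hvw
  have := le_csSup hK ⟨_, hP, rfl⟩
  rw [Finset.card_insert_of_notMem hxs] at this
  omega

/-- A bilinear form that is small on the product of two `1/2`-nets has small operator norm. -/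
lemma norm_apply_le_of_nets {s : Finset E} {s' : Finset F}
    (hs : ∀ x : E, ‖x‖ = 1 → ∃ v ∈ s, ‖x - v‖ < 1 / 2)
    (hs' : ∀ x : F, ‖x‖ = 1 → ∃ v ∈ s', ‖x - v‖ < 1 / 2) {T : E →ₗ[ℝ] F} {c : ℝ} (hc : 0 ≤ c)
    (h : ∀ v ∈ s, ∀ w ∈ s', inner ℝ w (T v) ≤ c) (x : E) : ‖T x‖ ≤ 4 * c * ‖x‖ := by
  have h1 : ∀ v ∈ s, ‖T v‖ ≤ 2 * c := fun v hv => norm_le_of_net hs' hc (h v hv)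
  have h2 : ‖T.adjoint (T x)‖ ≤ 2 * (‖T x‖ * (2 * c)) := by
    refine norm_le_of_net hs (by positivity) fun v hv => ?_
    rw [LinearMap.adjoint_inner_right, real_inner_comm]
    exact (real_inner_le_norm _ _).trans (by gcongr; exact h1 v hv)
  have h3 : ‖T x‖ ^ 2 ≤ ‖T.adjoint (T x)‖ * ‖x‖ := by
    rw [← real_inner_self_eq_norm_sq, ← LinearMap.adjoint_inner_left]
    exact real_inner_le_norm _ _
  rcases (norm_nonneg (T x)).eq_or_lt with h0 | h0
  · rw [← h0]; positivity
  · have : ‖T x‖ * ‖T x‖ ≤ ‖T x‖ * (4 * c * ‖x‖) := by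
      nlinarith [norm_nonneg x]
    exact le_of_mul_le_mul_left this h0

end Nets

/-! ### Concentration of empirical cross-covariances -/

section Concentration

variable {Ω ι κ : Type*} [MeasurableSpace Ω] [Fintype ι] [Fintype κ] {μ : Measure Ω}

/-- Sub-Gaussianity of the normalized one-dimensional marginals. -/
lemma IsSubGaussianVec.hasSubgaussianMGF {X : Ω → EuclideanSpace ℝ ι} {σ : ℝ}
    (hX : IsSubGaussianVec X σ μ) {v : EuclideanSpace ℝ ι} (hv : ‖v‖ = 1) :
    HasSubgaussianMGF (fun ω => σ⁻¹ * inner ℝ v (X ω)) 1 μ := by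
  have h := (hX.subgaussian v hv).const_mul σ⁻¹
  convert h using 1
  have := hX.param_pos
  ext
  change (1 : ℝ) = σ⁻¹ ^ 2 * ((σ ^ 2).toNNReal : ℝ)
  rw [Real.coe_toNNReal _ (sq_nonneg σ)]
  field_simp

/-- Cross-covariances of independent sub-Gaussian vectors concentrate in operator norm: apply the
scalar tail bound at all pairs of points of two nets. No independence between `a i` and `b i` is
needed. -/
lemma measure_not_norm_sum_sub_le [IsProbabilityMeasure μ] {N : ℕ} (hN : 0 < N)
    {a : Fin N → Ω → EuclideanSpace ℝ ι} {b : Fin N → Ω → EuclideanSpace ℝ κ} {σ τ : ℝ}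
    (hσ : 0 < σ) (hτ : 0 < τ)
    (ha : ∀ i, IsSubGaussianVec (a i) σ μ) (hb : ∀ i, IsSubGaussianVec (b i) τ μ)
    (ham : ∀ i, Measurable (a i)) (hbm : ∀ i, Measurable (b i))
    (hind : iIndepFun (fun i ω => (a i ω, b i ω)) μ)
    (C : EuclideanSpace ℝ κ →ₗ[ℝ] EuclideanSpace ℝ ι)
    (hC : ∀ i v w, ∫ ω, inner ℝ v (a i ω) * inner ℝ w (b i ω) ∂μ = inner ℝ v (C w))
    {t : ℝ} (ht0 : 0 ≤ t) (ht : t ≤ 9 / 2) :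
    μ {ω | ¬ ∀ y, ‖(N : ℝ)⁻¹ • ∑ i, (inner ℝ (b i ω) y : ℝ) • a i ω - C y‖ ≤
        4 * (σ * τ * t) * ‖y‖} ≤
      ENNReal.ofReal (5 ^ Fintype.card ι * 5 ^ Fintype.card κ *
        Real.exp (-(N * t ^ 2 / 72))) := by
  obtain ⟨s, hs1, hsc, hs⟩ := exists_net (EuclideanSpace ℝ ι)
  obtain ⟨s', hs1', hsc', hs'⟩ := exists_net (EuclideanSpace ℝ κ)
  rw [finrank_euclideanSpace] at hsc hsc'
  have hN' : (0 : ℝ) < N := by exact_mod_cast hN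
  let B : EuclideanSpace ℝ ι × EuclideanSpace ℝ κ → Set Ω := fun p =>
    {ω | N * (σ⁻¹ * τ⁻¹ * inner ℝ p.1 (C p.2) + t) ≤
      ∑ i, (σ⁻¹ * inner ℝ p.1 (a i ω)) * (τ⁻¹ * inner ℝ p.2 (b i ω))}
  have hB : ∀ p ∈ s ×ˢ s', μ (B p) ≤ ENNReal.ofReal (Real.exp (-(N * t ^ 2 / 72))) := by
    intro p hp
    obtain ⟨hp1, hp2⟩ := Finset.mem_product.1 hp
    rw [← ofReal_measureReal]
    refine ENNReal.ofReal_le_ofReal (measure_sum_mul_ge_le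
      (fun i => (ha i).hasSubgaussianMGF (hs1 _ hp1))
      (fun i => (hb i).hasSubgaussianMGF (hs1' _ hp2)) ?_ ?_ ?_ ht0 ht)
    · intro i
      have := ham i
      have := hbm i
      fun_prop
    · exact hind.comp (fun _ q => (σ⁻¹ * inner ℝ p.1 q.1) * (τ⁻¹ * inner ℝ p.2 q.2))
        fun i => by fun_prop
    · intro i
      rw [← hC i, ← integral_const_mul]
      congr 1; ext ω; ring
  have hsub : {ω | ¬ ∀ y, ‖(N : ℝ)⁻¹ • ∑ i, (inner ℝ (b i ω) y : ℝ) • a i ω - C y‖ ≤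
      4 * (σ * τ * t) * ‖y‖} ⊆ ⋃ p ∈ s ×ˢ s', B p := by
    intro ω hω
    by_contra hout
    refine hω fun y => ?_
    let T : EuclideanSpace ℝ κ →ₗ[ℝ] EuclideanSpace ℝ ι :=
      (N : ℝ)⁻¹ • (∑ i, (innerₛₗ ℝ (b i ω)).smulRight (a i ω)) - C
    have hT : ∀ y, T y = (N : ℝ)⁻¹ • ∑ i, (inner ℝ (b i ω) y : ℝ) • a i ω - C y := by
      intro y; simp [T, LinearMap.sum_apply]
    rw [← hT]
    refine norm_apply_le_of_nets hs' hs (by positivity) (fun w hw v hv => ?_) y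
    simp only [Set.mem_iUnion, not_exists] at hout
    have h := hout (v, w) (Finset.mk_mem_product hv hw)
    simp only [B, Set.mem_ofPred_eq, not_le] at h
    have h1 : ∑ i, (σ⁻¹ * inner ℝ v (a i ω)) * (τ⁻¹ * inner ℝ w (b i ω)) =
        σ⁻¹ * τ⁻¹ * ∑ i, inner ℝ (b i ω) w * inner ℝ v (a i ω) := by
      rw [Finset.mul_sum]
      refine Finset.sum_congr rfl fun i _ => ?_
      rw [real_inner_comm w]; ring
    rw [hT, inner_sub_right, real_inner_smul_right, inner_sum]
    simp only [real_inner_smul_right]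
    rw [h1] at h
    have h2 : (N : ℝ)⁻¹ * (σ * τ) * (σ⁻¹ * τ⁻¹ * ∑ i, inner ℝ (b i ω) w * inner ℝ v (a i ω)) ≤
        (N : ℝ)⁻¹ * (σ * τ) * (N * (σ⁻¹ * τ⁻¹ * inner ℝ v (C w) + t)) := by
      gcongr
    field_simp at h2 ⊢
    linarith
  refine (measure_mono hsub).trans ((measure_biUnion_finset_le _ _).trans
    ((Finset.sum_le_sum hB).trans ?_))
  rw [Finset.sum_const, nsmul_eq_mul, Finset.card_product, ENNReal.ofReal_mul (by positivity)]
  gcongr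
  rw [← ENNReal.ofReal_natCast]
  refine ENNReal.ofReal_le_ofReal ?_
  push_cast
  have h1 : (s.card : ℝ) ≤ 5 ^ Fintype.card ι := by exact_mod_cast hsc
  have h2 : (s'.card : ℝ) ≤ 5 ^ Fintype.card κ := by exact_mod_cast hsc'
  gcongr

end Concentration

/-! ### Duality for the nuclear norm -/

section SingularValues

open Module LinearMap

variable {E F : Type*} [NormedAddCommGroup E] [InnerProductSpace ℝ E] [FiniteDimensional ℝ E]
  [NormedAddCommGroup F] [InnerProductSpace ℝ F] [FiniteDimensional ℝ F] {n : ℕ}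

lemma inner_apply_eigenvectorBasis (T : E →ₗ[ℝ] F) (hn : finrank ℝ E = n) (j k : Fin n) :
    inner ℝ (T (T.isSymmetric_adjoint_comp_self.eigenvectorBasis hn j))
      (T (T.isSymmetric_adjoint_comp_self.eigenvectorBasis hn k)) =
      if j = k then T.singularValues k ^ 2 else 0 := by
  have h := T.isSymmetric_adjoint_comp_self.apply_eigenvectorBasis hn k
  rw [← LinearMap.adjoint_inner_right, ← LinearMap.comp_apply, h, real_inner_smul_right,
    OrthonormalBasis.inner_eq_ite, sq_singularValues_fin T hn]
  split_ifs <;> simp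

lemma norm_apply_eigenvectorBasis (T : E →ₗ[ℝ] F) (hn : finrank ℝ E = n) (k : Fin n) :
    ‖T (T.isSymmetric_adjoint_comp_self.eigenvectorBasis hn k)‖ = T.singularValues k := by
  rw [← sq_eq_sq₀ (norm_nonneg _) (singularValues_nonneg _ _), ← real_inner_self_eq_norm_sq,
    inner_apply_eigenvectorBasis, if_pos rfl]

lemma trace_adjoint_comp (U T : E →ₗ[ℝ] F) {ι : Type*} [Fintype ι] (b : OrthonormalBasis ι ℝ E) :
    LinearMap.trace ℝ E (U.adjoint ∘ₗ T) = ∑ k, inner ℝ (U (b k)) (T (b k)) := by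
  rw [LinearMap.trace_eq_sum_inner _ b]
  exact Finset.sum_congr rfl fun k _ => by
    rw [LinearMap.comp_apply, LinearMap.adjoint_inner_right]

lemma trace_adjoint_comp_le (T U : E →ₗ[ℝ] F) (hU : ∀ x, ‖U x‖ ≤ ‖x‖) (hn : finrank ℝ E = n) :
    LinearMap.trace ℝ E (U.adjoint ∘ₗ T) ≤ ∑ k : Fin n, T.singularValues k := by
  rw [trace_adjoint_comp U T (T.isSymmetric_adjoint_comp_self.eigenvectorBasis hn)]
  refine Finset.sum_le_sum fun k _ => (real_inner_le_norm _ _).trans ?_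
  rw [norm_apply_eigenvectorBasis]
  refine mul_le_of_le_one_left (singularValues_nonneg _ _) ((hU _).trans_eq ?_)
  exact OrthonormalBasis.norm_eq_one _ k

/-- The sum of the singular values is attained as a pairing with a contraction, the partial
isometry of the polar decomposition. -/
lemma exists_contraction_trace_eq (T : E →ₗ[ℝ] F) (hn : finrank ℝ E = n) :
    ∃ U : E →ₗ[ℝ] F, (∀ x, ‖U x‖ ≤ ‖x‖) ∧
      LinearMap.trace ℝ E (U.adjoint ∘ₗ T) = ∑ k : Fin n, T.singularValues k := by
  set e := T.isSymmetric_adjoint_comp_self.eigenvectorBasis hn with he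
  -- for a vanishing singular value the inverse is `0`, and `U` kills the basis vector
  let U : E →ₗ[ℝ] F := ∑ k : Fin n,
    (innerₛₗ ℝ (e k)).smulRight ((T.singularValues k)⁻¹ • T (e k))
  have hU : ∀ x, U x = ∑ k : Fin n, (inner ℝ (e k) x * (T.singularValues k)⁻¹) • T (e k) := by
    intro x; simp [U, LinearMap.sum_apply, smul_smul]
  have hUe : ∀ k, U (e k) = (T.singularValues k)⁻¹ • T (e k) := by
    intro k
    rw [hU, Finset.sum_eq_single k]
    · rw [OrthonormalBasis.inner_eq_ite, if_pos rfl, one_mul]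
    · intro j _ hj
      rw [OrthonormalBasis.inner_eq_ite, if_neg hj, zero_mul, zero_smul]
    · simp
  refine ⟨U, fun x => ?_, ?_⟩
  · rw [← sq_le_sq₀ (norm_nonneg _) (norm_nonneg _), ← e.sum_sq_norm_inner_right x,
      ← real_inner_self_eq_norm_sq, hU, sum_inner]
    refine Finset.sum_le_sum fun j _ => ?_
    rw [inner_sum, Finset.sum_eq_single j]
    · rw [real_inner_smul_left, real_inner_smul_right, inner_apply_eigenvectorBasis, if_pos rfl,
        Real.norm_eq_abs, sq_abs]
      rcases eq_or_ne (T.singularValues j) 0 with h0 | h0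
      · rw [h0]; simp [sq_nonneg]
      · apply le_of_eq; field_simp
    · intro k _ hk
      rw [real_inner_smul_left, real_inner_smul_right, inner_apply_eigenvectorBasis,
        if_neg (Ne.symm hk)]
      simp
    · simp
  · rw [trace_adjoint_comp U T e]
    refine Finset.sum_congr rfl fun k _ => ?_
    rw [hUe, real_inner_smul_left, inner_apply_eigenvectorBasis, if_pos rfl]
    rcases eq_or_ne (T.singularValues k) 0 with h0 | h0
    · rw [h0]; simp
    · field_simp

lemma singularValues_mul_norm_le (T : E →ₗ[ℝ] F) (hn : finrank ℝ E = n) (x : E) :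
    T.singularValues (n - 1) * ‖x‖ ≤ ‖T x‖ := by
  set e := T.isSymmetric_adjoint_comp_self.eigenvectorBasis hn with he
  rw [← sq_le_sq₀ (mul_nonneg (singularValues_nonneg _ _) (norm_nonneg _)) (norm_nonneg _),
    mul_pow, ← e.sum_sq_norm_inner_right x, Finset.mul_sum, ← real_inner_self_eq_norm_sq,
    ← LinearMap.adjoint_inner_right, ← LinearMap.comp_apply, ← e.sum_inner_mul_inner]
  refine Finset.sum_le_sum fun k _ => ?_
  rw [← LinearMap.isSymmetric_adjoint_comp_self T (e k) x,
    T.isSymmetric_adjoint_comp_self.apply_eigenvectorBasis hn k, ← he, ← sq_singularValues_fin T hn,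
    real_inner_smul_left, real_inner_comm x (e k), Real.norm_eq_abs, sq_abs]
  have h : T.singularValues (n - 1) ^ 2 ≤ T.singularValues k ^ 2 :=
    pow_le_pow_left₀ (singularValues_nonneg _ _)
      (singularValues_antitone T (by have := k.isLt; omega)) 2
  simp only [RCLike.ofReal_real_eq_id, id_eq]
  nlinarith [sq_nonneg (inner ℝ (e k) x)]

end SingularValues

section NuclearNorm

variable {ι κ : Type*} [Fintype ι] [Fintype κ] [DecidableEq κ]

lemma nuclearNorm_eq_sum (M : Matrix ι κ ℝ) :
    nuclearNorm M = ∑ k : Fin (Fintype.card κ), (Matrix.toEuclideanLin M).singularValues k := by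
  rw [nuclearNorm, ← Finset.sum_range (fun k => (Matrix.toEuclideanLin M).singularValues k)]
  refine Finset.sum_subset (Finset.range_mono (min_le_right _ _)) fun k hk hk' => ?_
  rw [Finset.mem_range] at hk hk'
  rw [singularValue, LinearMap.singularValues_eq_zero_iff_le_finrank_range]
  refine (Submodule.finrank_le _).trans ?_
  rw [finrank_euclideanSpace]
  omega

lemma nuclearNorm_nonneg (M : Matrix ι κ ℝ) : 0 ≤ nuclearNorm M :=
  Finset.sum_nonneg fun _ _ => LinearMap.singularValues_nonneg _ _

/-- The variational inequality of the nuclear norm, with the contraction that is optimal for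
`M + D`. -/
lemma nuclearNorm_add_le_trace (M D : Matrix ι κ ℝ) :
    ∃ U : EuclideanSpace ℝ κ →ₗ[ℝ] EuclideanSpace ℝ ι, (∀ x, ‖U x‖ ≤ ‖x‖) ∧
      nuclearNorm (M + D) ≤ nuclearNorm M +
        LinearMap.trace ℝ _ (U.adjoint ∘ₗ Matrix.toEuclideanLin D) := by
  obtain ⟨U, hU, h⟩ := exists_contraction_trace_eq (Matrix.toEuclideanLin (M + D))
    finrank_euclideanSpace
  refine ⟨U, hU, ?_⟩
  rw [nuclearNorm_eq_sum, ← h, map_add, LinearMap.comp_add, map_add, nuclearNorm_eq_sum]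
  gcongr
  exact trace_adjoint_comp_le _ U hU finrank_euclideanSpace

lemma nuclearNorm_add_vecMulVec_le (M : Matrix ι κ ℝ) (p : EuclideanSpace ℝ ι)
    (q : EuclideanSpace ℝ κ) :
    nuclearNorm (M + Matrix.vecMulVec p q) ≤ nuclearNorm M + ‖p‖ * ‖q‖ := by
  obtain ⟨U, hU, h⟩ := nuclearNorm_add_le_trace M (Matrix.vecMulVec p q)
  refine h.trans ?_
  gcongr
  have hD : ∀ x, Matrix.toEuclideanLin (Matrix.vecMulVec p q) x = (inner ℝ q x : ℝ) • p := by
    intro x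
    ext i
    simp [Matrix.toLpLin_apply, Matrix.mulVec, dotProduct, Matrix.vecMulVec_apply,
      PiLp.inner_apply, mul_comm]
    rw [Finset.mul_sum]
    exact Finset.sum_congr rfl fun k _ => by ring
  set b := EuclideanSpace.basisFun κ ℝ
  rw [trace_adjoint_comp U _ b]
  have : ∑ k, inner ℝ (U (b k)) (Matrix.toEuclideanLin (Matrix.vecMulVec p q) (b k)) =
      inner ℝ (U q) p := by
    conv_rhs => rw [← b.sum_repr' q, map_sum, sum_inner]
    refine Finset.sum_congr rfl fun k _ => ?_
    rw [hD, real_inner_smul_right, map_smul, real_inner_smul_left, real_inner_comm]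
  rw [this, mul_comm]
  exact (real_inner_le_norm _ _).trans (by gcongr; exact hU q)

lemma nuclearNorm_add_le_sum (M D : Matrix ι κ ℝ) :
    nuclearNorm (M + D) ≤ nuclearNorm M +
      ∑ k, ‖Matrix.toEuclideanLin D (EuclideanSpace.basisFun κ ℝ k)‖ := by
  obtain ⟨U, hU, h⟩ := nuclearNorm_add_le_trace M D
  refine h.trans ?_
  rw [trace_adjoint_comp U _ (EuclideanSpace.basisFun κ ℝ)]
  gcongr with k
  refine (real_inner_le_norm _ _).trans (mul_le_of_le_one_left (norm_nonneg _) ((hU _).trans_eq ?_))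
  exact OrthonormalBasis.norm_eq_one _ k

lemma continuous_nuclearNorm : Continuous (nuclearNorm : Matrix ι κ ℝ → ℝ) := by
  rw [continuous_iff_continuousAt]
  intro M₀
  have hL : ∀ k, Continuous fun M : Matrix ι κ ℝ =>
      Matrix.toEuclideanLin M (EuclideanSpace.basisFun κ ℝ k) := by
    intro k
    simp only [Matrix.toLpLin_apply]
    fun_prop
  rw [ContinuousAt, tendsto_iff_dist_tendsto_zero]
  let g : Matrix ι κ ℝ → ℝ := fun M =>
    ∑ k, ‖Matrix.toEuclideanLin (M - M₀) (EuclideanSpace.basisFun κ ℝ k)‖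
  have hg : Filter.Tendsto g (nhds M₀) (nhds 0) := by
    have hgc : Continuous g := continuous_finsetSum _ fun k _ =>
      ((hL k).comp (continuous_id.sub continuous_const)).norm
    have := hgc.tendsto M₀
    simpa [g] using this
  refine squeeze_zero (fun _ => dist_nonneg) (fun M => ?_) hg
  rw [Real.dist_eq, abs_le]
  have h1 := nuclearNorm_add_le_sum M₀ (M - M₀)
  have h2 := nuclearNorm_add_le_sum M (M₀ - M)
  rw [add_sub_cancel] at h1 h2
  have h3 : ∑ k, ‖Matrix.toEuclideanLin (M₀ - M) (EuclideanSpace.basisFun κ ℝ k)‖ = g M := by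
    refine Finset.sum_congr rfl fun k _ => ?_
    rw [← neg_sub M, map_neg, LinearMap.neg_apply, norm_neg]
  rw [h3] at h2
  constructor <;> linarith

end NuclearNorm

/-! ### Solutions of the regularized program -/

section Frobenius

lemma toEuclideanLin_mul_apply {ι ρ κ : Type*} [Fintype ρ] [DecidableEq ρ]
    [Fintype κ] [DecidableEq κ] (M : Matrix ι ρ ℝ) (M' : Matrix ρ κ ℝ) (x : EuclideanSpace ℝ κ) :
    Matrix.toEuclideanLin (M * M') x =
      Matrix.toEuclideanLin M (Matrix.toEuclideanLin M' x) := by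
  simp [Matrix.toLpLin_apply]

variable {ι κ : Type*} [Fintype ι] [Fintype κ]

lemma frobNorm_sq (M : Matrix ι κ ℝ) : frobNorm M ^ 2 = ∑ j, ∑ i, M i j ^ 2 := by
  have h : (M.transpose * M).trace = ∑ j, ∑ i, M i j ^ 2 := by
    simp [Matrix.trace, Matrix.mul_apply, sq]
  rw [frobNorm, h, Real.sq_sqrt (by positivity)]

lemma frobNorm_nonneg (M : Matrix ι κ ℝ) : 0 ≤ frobNorm M := Real.sqrt_nonneg _

lemma continuous_frobNorm : Continuous (frobNorm : Matrix ι κ ℝ → ℝ) := by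
  unfold frobNorm
  fun_prop

variable [DecidableEq κ]

lemma norm_toEuclideanLin_single_sq (M : Matrix ι κ ℝ) (j : κ) :
    ‖Matrix.toEuclideanLin M (EuclideanSpace.single j 1)‖ ^ 2 = ∑ i, M i j ^ 2 := by
  rw [EuclideanSpace.norm_sq_eq]
  simp [Matrix.toLpLin_apply]

lemma norm_toEuclideanLin_single_le (M : Matrix ι κ ℝ) (j : κ) :
    ‖Matrix.toEuclideanLin M (EuclideanSpace.single j 1)‖ ≤ frobNorm M := by
  rw [← sq_le_sq₀ (norm_nonneg _) (frobNorm_nonneg M), frobNorm_sq,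
    norm_toEuclideanLin_single_sq]
  exact Finset.single_le_sum (f := fun j => ∑ i, M i j ^ 2)
    (fun _ _ => by positivity) (Finset.mem_univ j)

lemma abs_apply_le_norm_toEuclideanLin_single (M : Matrix ι κ ℝ) (i : ι) (j : κ) :
    |M i j| ≤ ‖Matrix.toEuclideanLin M (EuclideanSpace.single j 1)‖ := by
  rw [← sq_le_sq₀ (abs_nonneg _) (norm_nonneg _), norm_toEuclideanLin_single_sq, sq_abs]
  exact Finset.single_le_sum (f := fun i => M i j ^ 2)
    (fun _ _ => by positivity) (Finset.mem_univ i)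

end Frobenius

section Solutions

variable {n m N : ℕ}

lemma continuous_objective (X : Matrix (Fin N) (Fin n) ℝ) (Z : Matrix (Fin N) (Fin n ⊕ Fin m) ℝ)
    (lam : ℝ) : Continuous (objective X Z lam) := by
  have h1 : Continuous fun Θ : Matrix (Fin n ⊕ Fin m) (Fin n) ℝ => frobNorm (X - Z * Θ) :=
    continuous_frobNorm.comp (by fun_prop)
  exact ((h1.pow 2).const_mul _).add (continuous_nuclearNorm.const_mul lam)

/-- Injectivity of the design matrix alone makes the objective coercive. -/
lemma exists_isSolution (hN : 0 < N) (X : Matrix (Fin N) (Fin n) ℝ)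
    (Z : Matrix (Fin N) (Fin n ⊕ Fin m) ℝ) {lam : ℝ} (hlam : 0 ≤ lam) {c : ℝ} (hc : 0 < c)
    (hZ : ∀ x, c * ‖x‖ ≤ ‖Matrix.toEuclideanLin Z x‖) : ∃ Θ, IsSolution X Z lam Θ := by
  have hN' : (0 : ℝ) < N := by exact_mod_cast hN
  set v := objective X Z lam 0 with hv
  set R : ℝ := (frobNorm X + Real.sqrt (2 * N * v)) / c with hR
  let K : Set (Matrix (Fin n ⊕ Fin m) (Fin n) ℝ) :=
    Set.pi Set.univ fun _ => Set.pi Set.univ fun _ => Set.Icc (-R) R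
  have hK : IsCompact K := isCompact_univ_pi fun _ => isCompact_univ_pi fun _ => isCompact_Icc
  have hR0 : 0 ≤ R := div_nonneg (add_nonneg (frobNorm_nonneg _) (Real.sqrt_nonneg _)) hc.le
  have h0K : (0 : Matrix (Fin n ⊕ Fin m) (Fin n) ℝ) ∈ K := by
    refine fun i _ j _ => ?_
    simp [hR0]
  have hsub : ∀ Θ, objective X Z lam Θ ≤ v → Θ ∈ K := by
    intro Θ hΘ
    have h1 : frobNorm (X - Z * Θ) ≤ Real.sqrt (2 * N * v) := by
      refine Real.le_sqrt_of_sq_le ?_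
      have h2 : 1 / (2 * (N : ℝ)) * frobNorm (X - Z * Θ) ^ 2 ≤ v :=
        le_trans (le_add_of_nonneg_right (mul_nonneg hlam (nuclearNorm_nonneg Θ))) hΘ
      rw [one_div, inv_mul_le_iff₀ (by positivity)] at h2
      exact h2
    refine fun i _ j _ => Set.mem_Icc.2 (abs_le.1 ?_)
    refine (abs_apply_le_norm_toEuclideanLin_single Θ i j).trans ?_
    rw [hR, le_div_iff₀ hc, mul_comm]
    refine (hZ _).trans ?_
    have h3 : Matrix.toEuclideanLin Z (Matrix.toEuclideanLin Θ (EuclideanSpace.single j 1)) =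
        Matrix.toEuclideanLin X (EuclideanSpace.single j 1) -
          Matrix.toEuclideanLin (X - Z * Θ) (EuclideanSpace.single j 1) := by
      rw [map_sub, LinearMap.sub_apply, toEuclideanLin_mul_apply]; abel
    rw [h3]
    exact (norm_sub_le _ _).trans (add_le_add (norm_toEuclideanLin_single_le X j)
      ((norm_toEuclideanLin_single_le _ j).trans h1))
  obtain ⟨Θ, -, hΘ⟩ := hK.exists_isMinOn ⟨0, h0K⟩ (continuous_objective X Z lam).continuousOn
  refine ⟨Θ, fun Θ' => ?_⟩
  by_cases hΘ' : objective X Z lam Θ' ≤ v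
  · exact hΘ (hsub Θ' hΘ')
  · exact (hΘ h0K).trans (not_le.1 hΘ').le

/-- First-order optimality: the gradient of the quadratic loss at a solution has operator norm at
most `lam`. It is tested on rank-one perturbations. -/
lemma IsSolution.inner_le (hN : 0 < N) {X : Matrix (Fin N) (Fin n) ℝ}
    {Z : Matrix (Fin N) (Fin n ⊕ Fin m) ℝ} {lam : ℝ} (hlam : 0 ≤ lam)
    {Θ : Matrix (Fin n ⊕ Fin m) (Fin n) ℝ} (hΘ : IsSolution X Z lam Θ)
    (p : EuclideanSpace ℝ (Fin n ⊕ Fin m)) (q : EuclideanSpace ℝ (Fin n)) :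
    (N : ℝ)⁻¹ * inner ℝ (Matrix.toEuclideanLin Z p) (Matrix.toEuclideanLin (X - Z * Θ) q) ≤
      lam * (‖p‖ * ‖q‖) := by
  have hN' : (0 : ℝ) < N := by exact_mod_cast hN
  set R := X - Z * Θ with hR
  set a : ℝ := inner ℝ (Matrix.toEuclideanLin Z p) (Matrix.toEuclideanLin R q) with ha
  set y := Matrix.toEuclideanLin Z p with hy
  set d : ℝ := ∑ j, ∑ i, (y i * q j) ^ 2 with hd
  have hd0 : 0 ≤ d := by positivity
  have key : ∀ ε : ℝ, 0 < ε → (N : ℝ)⁻¹ * a ≤ lam * (‖p‖ * ‖q‖) + ε * ((2 * (N : ℝ))⁻¹ * d) := by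
    intro ε hε
    have h1 := hΘ (Θ + Matrix.vecMulVec (ε • p : EuclideanSpace ℝ _) q)
    have h2 := nuclearNorm_add_vecMulVec_le Θ (ε • p) q
    rw [norm_smul, Real.norm_of_nonneg hε.le] at h2
    have h3 : frobNorm (X - Z * (Θ + Matrix.vecMulVec (ε • p : EuclideanSpace ℝ _) q)) ^ 2 =
        frobNorm R ^ 2 - 2 * ε * a + ε ^ 2 * d := by
      have h4 : ∀ i j, (X - Z * (Θ + Matrix.vecMulVec (ε • p : EuclideanSpace ℝ _) q)) i j =
          R i j - ε * (y i * q j) := by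
        intro i j
        have h5 : y i = ∑ k, Z i k * p k := by
          simp [hy, Matrix.toLpLin_apply, Matrix.mulVec, dotProduct]
        rw [h5, hR, Matrix.mul_add, ← sub_sub, Matrix.sub_apply]
        congr 1
        rw [Matrix.mul_apply, Finset.sum_mul, Finset.mul_sum]
        refine Finset.sum_congr rfl fun k _ => ?_
        simp [Matrix.vecMulVec_apply]
        ring
      have h6 : a = ∑ j, ∑ i, R i j * (y i * q j) := by
        rw [ha, PiLp.inner_apply, Finset.sum_comm]
        refine Finset.sum_congr rfl fun i _ => ?_
        simp only [Matrix.toLpLin_apply, Matrix.mulVec, dotProduct, RCLike.inner_apply,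
          conj_trivial, Finset.sum_mul]
        exact Finset.sum_congr rfl fun j _ => by ring
      rw [frobNorm_sq, frobNorm_sq, h6, hd]
      simp only [h4, Finset.mul_sum, ← Finset.sum_sub_distrib, ← Finset.sum_add_distrib]
      exact Finset.sum_congr rfl fun j _ => Finset.sum_congr rfl fun i _ => by ring
    simp only [objective] at h1
    rw [h3, ← hR] at h1
    have h7 : lam * nuclearNorm (Θ + Matrix.vecMulVec (ε • p : EuclideanSpace ℝ _) q) ≤
        lam * (nuclearNorm Θ + ε * ‖p‖ * ‖q‖) := by gcongr
    have h8 : ε * ((N : ℝ)⁻¹ * a) ≤ ε * (lam * (‖p‖ * ‖q‖) + ε * ((2 * (N : ℝ))⁻¹ * d)) := by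
      have h9 : 1 / (2 * (N : ℝ)) * (frobNorm R ^ 2 - 2 * ε * a + ε ^ 2 * d) =
          1 / (2 * (N : ℝ)) * frobNorm R ^ 2 - ε * ((N : ℝ)⁻¹ * a) +
            ε ^ 2 * ((2 * (N : ℝ))⁻¹ * d) := by
        field_simp
      rw [h9] at h1
      nlinarith
    exact le_of_mul_le_mul_left h8 hε
  have hlim : Filter.Tendsto (fun ε : ℝ => lam * (‖p‖ * ‖q‖) + ε * ((2 * (N : ℝ))⁻¹ * d))
      (nhdsWithin 0 (Set.Ioi 0)) (nhds (lam * (‖p‖ * ‖q‖))) := by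
    have hcont : Continuous fun ε : ℝ => lam * (‖p‖ * ‖q‖) + ε * ((2 * (N : ℝ))⁻¹ * d) := by
      fun_prop
    simpa using (hcont.tendsto 0).mono_left nhdsWithin_le_nhds
  refine ge_of_tendsto hlim ?_
  filter_upwards [self_mem_nhdsWithin] with ε hε using key ε hε

lemma opNorm_le_of_forall {ι κ : Type*} [Fintype ι] [Fintype κ] [DecidableEq κ]
    {M : Matrix ι κ ℝ} {c : ℝ} (hc : 0 ≤ c)
    (h : ∀ x, ‖Matrix.toEuclideanLin M x‖ ≤ c * ‖x‖) : opNorm M ≤ c :=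
  ContinuousLinearMap.opNorm_le_bound _ hc h

/-- If the Gram form of the design matrix dominates `γ' ‖x‖²` and the noise term has operator norm
at most `ρ`, then the normal equations bound the error of a solution in operator norm. -/
lemma IsSolution.opNorm_sub_le (hN : 0 < N) {Z : Matrix (Fin N) (Fin n ⊕ Fin m) ℝ}
    {W : Matrix (Fin N) (Fin n) ℝ} {Θ' Θ : Matrix (Fin n ⊕ Fin m) (Fin n) ℝ} {lam γ ρ : ℝ}
    (hlam : 0 ≤ lam) (hγ : 0 < γ) (hρ : 0 ≤ ρ)
    (hΘ : IsSolution (Z * Θ' + W) Z lam Θ)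
    (hZ : ∀ x, γ * ‖x‖ ^ 2 ≤ (N : ℝ)⁻¹ * ‖Matrix.toEuclideanLin Z x‖ ^ 2)
    (hW : ∀ p q, (N : ℝ)⁻¹ * inner ℝ (Matrix.toEuclideanLin Z p) (Matrix.toEuclideanLin W q) ≤
      ρ * (‖p‖ * ‖q‖)) :
    opNorm (Θ - Θ') ≤ (lam + ρ) / γ := by
  refine opNorm_le_of_forall (by positivity) fun q => ?_
  set p := Matrix.toEuclideanLin (Θ - Θ') q with hp
  -- the optimality condition is tested in the direction that lowers the error
  have h1 := hΘ.inner_le hN hlam (-p) q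
  have h2 : Matrix.toEuclideanLin (Z * Θ' + W - Z * Θ) q =
      Matrix.toEuclideanLin W q - Matrix.toEuclideanLin Z p := by
    rw [hp, ← toEuclideanLin_mul_apply, ← LinearMap.sub_apply, ← map_sub]
    congr 2
    rw [Matrix.mul_sub]; abel
  rw [h2, map_neg, inner_neg_left, inner_sub_right, real_inner_self_eq_norm_sq, norm_neg] at h1
  have h3 := hZ p
  have h4 := hW p q
  have h6 : ‖p‖ * (γ * ‖p‖) ≤ ‖p‖ * ((lam + ρ) * ‖q‖) := by nlinarith
  rcases (norm_nonneg p).eq_or_lt with h0 | h0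
  · rw [← h0]; positivity
  · have := le_of_mul_le_mul_left h6 h0
    rw [div_mul_eq_mul_div, le_div_iff₀ hγ]
    linarith

end Solutions

/-! ### Moments of sub-Gaussian vectors -/

section Moments

variable {Ω ι : Type*} [MeasurableSpace Ω] [Fintype ι] {μ : Measure Ω}

lemma IsSubGaussianVec.integral_inner_eq_zero [IsProbabilityMeasure μ]
    {X : Ω → EuclideanSpace ℝ ι} {σ : ℝ} (hX : IsSubGaussianVec X σ μ) (v : EuclideanSpace ℝ ι) :
    ∫ ω, inner ℝ v (X ω) ∂μ = 0 := by
  classical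
  have hint : Integrable X μ := by
    have h : X = fun ω => ∑ j, (inner ℝ (EuclideanSpace.basisFun ι ℝ j) (X ω) : ℝ) •
        EuclideanSpace.basisFun ι ℝ j := by
      ext1 ω; exact ((EuclideanSpace.basisFun ι ℝ).sum_repr' (X ω)).symm
    rw [h]
    exact integrable_finsetSum _ fun j _ => ((hX.subgaussian _
      (OrthonormalBasis.norm_eq_one _ j)).integrable).smul_const _
  rw [integral_inner hint, hX.mean_zero, inner_zero_right]

lemma IsSubGaussianVec.integrable_inner_mul_inner [IsProbabilityMeasure μ]
    {X : Ω → EuclideanSpace ℝ ι} {σ : ℝ} (hX : IsSubGaussianVec X σ μ)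
    {v w : EuclideanSpace ℝ ι} (hv : ‖v‖ = 1) (hw : ‖w‖ = 1) :
    Integrable (fun ω => inner ℝ v (X ω) * inner ℝ w (X ω)) μ :=
  integrable_mul_of_subgaussian (hX.subgaussian v hv) (hX.subgaussian w hw)

lemma IsSubGaussianVec.integral_inner_mul_inner [IsProbabilityMeasure μ] [DecidableEq ι]
    {X : Ω → EuclideanSpace ℝ ι} {σ : ℝ} (hX : IsSubGaussianVec X σ μ)
    (v w : EuclideanSpace ℝ ι) :
    ∫ ω, inner ℝ v (X ω) * inner ℝ w (X ω) ∂μ =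
      inner ℝ v (Matrix.toEuclideanLin (covMatrix X μ) w) := by
  have hcoord : ∀ j ω, X ω j = inner ℝ (EuclideanSpace.single j (1 : ℝ)) (X ω) := by
    intro j ω; simp [EuclideanSpace.inner_single_left]
  have hcov : ∀ j k, covMatrix X μ j k = ∫ ω, X ω j * X ω k ∂μ := by
    intro j k
    have h0 : ∀ j, ∫ ω, X ω j ∂μ = 0 := fun j => by
      simp only [hcoord]; exact hX.integral_inner_eq_zero _
    simp [covMatrix, covariance, h0]
  have hint : ∀ j k, Integrable (fun ω => X ω j * X ω k) μ := fun j k => by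
    simp only [hcoord]; exact hX.integrable_inner_mul_inner (by simp) (by simp)
  have hexp : ∀ ω, inner ℝ v (X ω) * inner ℝ w (X ω) =
      ∑ j, ∑ k, v j * w k * (X ω j * X ω k) := by
    intro ω
    rw [PiLp.inner_apply, PiLp.inner_apply, Finset.sum_mul_sum]
    refine Finset.sum_congr rfl fun j _ => Finset.sum_congr rfl fun k _ => ?_
    simp only [RCLike.inner_apply, conj_trivial]; ring
  simp only [hexp]
  rw [integral_finsetSum _ fun j _ => integrable_finsetSum _ fun k _ => (hint j k).const_mul _,
    PiLp.inner_apply]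
  refine Finset.sum_congr rfl fun j _ => ?_
  rw [integral_finsetSum _ fun k _ => (hint j k).const_mul _]
  simp only [Matrix.toLpLin_apply, Matrix.mulVec, dotProduct, RCLike.inner_apply, conj_trivial,
    Finset.sum_mul]
  refine Finset.sum_congr rfl fun k _ => ?_
  rw [integral_const_mul, hcov]; ring

lemma IsSubGaussianVec.inner_covMatrix_le [IsProbabilityMeasure μ] [DecidableEq ι]
    {X : Ω → EuclideanSpace ℝ ι} {σ : ℝ} (hX : IsSubGaussianVec X σ μ)
    {v : EuclideanSpace ℝ ι} (hv : ‖v‖ = 1) :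
    inner ℝ v (Matrix.toEuclideanLin (covMatrix X μ) v) ≤ 8 / 3 * σ ^ 2 := by
  have h := integral_sq_le (hX.hasSubgaussianMGF hv)
  have hσ := hX.param_pos
  have h1 : ∀ ω, (σ⁻¹ * inner ℝ v (X ω)) ^ 2 =
      (σ ^ 2)⁻¹ * (inner ℝ v (X ω) * inner ℝ v (X ω)) := fun ω => by
    rw [mul_pow, inv_pow, sq (inner ℝ v (X ω))]
  simp only [h1] at h
  rw [integral_const_mul, hX.integral_inner_mul_inner, inv_mul_le_iff₀ (by positivity)] at h
  linarith

lemma mul_norm_sq_le_inner_of_isSymmetric {E : Type*} [NormedAddCommGroup E]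
    [InnerProductSpace ℝ E] [FiniteDimensional ℝ E] {T : E →ₗ[ℝ] E} (hT : T.IsSymmetric)
    (hpos : ∀ x, 0 ≤ inner ℝ x (T x)) {c : ℝ} (h : ∀ x, c * ‖x‖ ≤ ‖T x‖) (x : E) :
    c * ‖x‖ ^ 2 ≤ inner ℝ x (T x) := by
  set e := hT.eigenvectorBasis rfl with he
  have hev : ∀ k, T (e k) = hT.eigenvalues rfl k • e k := fun k => by
    exact hT.apply_eigenvectorBasis rfl k
  have hc : ∀ k, c ≤ hT.eigenvalues rfl k := by
    intro k
    have h1 := hpos (e k)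
    have h2 := h (e k)
    rw [hev, real_inner_smul_right, real_inner_self_eq_norm_sq, OrthonormalBasis.norm_eq_one] at h1
    rw [hev, norm_smul, OrthonormalBasis.norm_eq_one, Real.norm_of_nonneg (by linarith)] at h2
    linarith
  rw [← e.sum_sq_norm_inner_right x, Finset.mul_sum, ← e.sum_inner_mul_inner]
  refine Finset.sum_le_sum fun k _ => ?_
  rw [← hT (e k) x, hev, real_inner_smul_left, real_inner_comm x (e k), Real.norm_eq_abs, sq_abs]
  nlinarith [hc k, sq_nonneg (inner ℝ (e k) x)]

/-- The least singular value of a covariance matrix is a lower bound for its quadratic form. -/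
lemma IsSubGaussianVec.gammaMin_mul_norm_sq_le [IsProbabilityMeasure μ] [DecidableEq ι]
    {X : Ω → EuclideanSpace ℝ ι} {σ : ℝ} (hX : IsSubGaussianVec X σ μ)
    (v : EuclideanSpace ℝ ι) :
    gammaMin (covMatrix X μ) * ‖v‖ ^ 2 ≤
      inner ℝ v (Matrix.toEuclideanLin (covMatrix X μ) v) := by
  refine mul_norm_sq_le_inner_of_isSymmetric (fun v w => ?_) (fun v => ?_) (fun v => ?_) v
  · rw [← real_inner_comm, ← hX.integral_inner_mul_inner, ← hX.integral_inner_mul_inner]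
    simp only [mul_comm]
  · rw [← hX.integral_inner_mul_inner]
    exact integral_nonneg fun ω => mul_self_nonneg _
  · exact singularValues_mul_norm_le _ finrank_euclideanSpace v

end Moments

/-! ### Independence structure of the sampled system -/

section Independence

lemma indepFun_prodMk_left {Ω α β γ : Type*} [MeasurableSpace Ω] [MeasurableSpace α]
    [MeasurableSpace β] [MeasurableSpace γ] {μ : Measure Ω} [IsProbabilityMeasure μ]
    {U : Ω → α} {V : Ω → β} {Y : Ω → γ} (hU : Measurable U) (hV : Measurable V)
    (hY : Measurable Y) (h : IndepFun U (fun ω => (V ω, Y ω)) μ) (hVY : IndepFun V Y μ) :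
    IndepFun (fun ω => (U ω, V ω)) Y μ := by
  have hUV : IndepFun U V μ := h.comp measurable_id measurable_fst
  rw [indepFun_iff_map_prod_eq_prod_map_map (by fun_prop) (by fun_prop)] at h hVY hUV ⊢
  have := Measure.isProbabilityMeasure_map (μ := μ) hU.aemeasurable
  have := Measure.isProbabilityMeasure_map (μ := μ) hV.aemeasurable
  have := Measure.isProbabilityMeasure_map (μ := μ) hY.aemeasurable
  rw [hUV]
  apply MeasurableEquiv.prodAssoc.map_measurableEquiv_injective
  rw [Measure.prodAssoc_prod, ← hVY, ← h, Measure.map_map (by fun_prop) (by fun_prop)]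
  rfl

variable {n m : ℕ}

/-- The state at a given time, as a function of the input and noise sequences. -/
noncomputable def trajectory (A : Matrix (Fin n) (Fin n) ℝ) (B : Matrix (Fin n) (Fin m) ℝ)
    (u : ℕ → EuclideanSpace ℝ (Fin m)) (w : ℕ → EuclideanSpace ℝ (Fin n)) :
    ℕ → EuclideanSpace ℝ (Fin n)
  | 0 => 0
  | t + 1 => Matrix.toEuclideanLin A (trajectory A B u w t) + Matrix.toEuclideanLin B (u t) + w t

/-- Extension of a finite sequence by zeros. -/
noncomputable def extendZero {α : Type*} [Zero α] {T : ℕ} (p : Fin T → α) (t : ℕ) : α :=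
  if h : t < T then p ⟨t, h⟩ else 0

lemma measurable_extendZero {Ω α : Type*} [MeasurableSpace Ω] [Zero α] [MeasurableSpace α] {T : ℕ}
    {p : Ω → Fin T → α} (hp : Measurable p) (t : ℕ) : Measurable fun ω => extendZero (p ω) t := by
  unfold extendZero
  split_ifs <;> fun_prop

lemma measurable_toEuclideanLin {ι κ : Type*} [Fintype ι] [Fintype κ] [DecidableEq κ]
    (M : Matrix ι κ ℝ) : Measurable (Matrix.toEuclideanLin M) :=
  (LinearMap.continuous_of_finiteDimensional _).measurable

lemma measurable_trajectory {Ω : Type*} [MeasurableSpace Ω] (A : Matrix (Fin n) (Fin n) ℝ)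
    (B : Matrix (Fin n) (Fin m) ℝ) {u : Ω → ℕ → EuclideanSpace ℝ (Fin m)}
    {w : Ω → ℕ → EuclideanSpace ℝ (Fin n)} (hu : ∀ t, Measurable fun ω => u ω t)
    (hw : ∀ t, Measurable fun ω => w ω t) (t : ℕ) :
    Measurable fun ω => trajectory A B (u ω) (w ω) t := by
  induction t with
  | zero => exact measurable_const
  | succ t ih =>
    exact (((measurable_toEuclideanLin A).comp ih).add
      ((measurable_toEuclideanLin B).comp (hu t))).add (hw t)

lemma measurable_stack {Ω : Type*} [MeasurableSpace Ω] {x : Ω → EuclideanSpace ℝ (Fin n)}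
    {u : Ω → EuclideanSpace ℝ (Fin m)} (hx : Measurable x) (hu : Measurable u) :
    Measurable fun ω => stack (x ω) (u ω) := by
  refine (WithLp.measurable_toLp 2 _).comp (measurable_pi_lambda _ fun j => ?_)
  rcases j with j | j <;> simp only [Sum.elim_inl, Sum.elim_inr] <;> fun_prop

variable {Ω : Type*} [MeasurableSpace Ω] {μ : Measure Ω} {N T : ℕ}
  {A : Matrix (Fin n) (Fin n) ℝ} {B : Matrix (Fin n) (Fin m) ℝ}
  {x : Fin N → ℕ → Ω → EuclideanSpace ℝ (Fin n)}
  {u : Fin N → ℕ → Ω → EuclideanSpace ℝ (Fin m)}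
  {w : Fin N → ℕ → Ω → EuclideanSpace ℝ (Fin n)}

lemma IsSampledSystem.eq_trajectory (h : IsSampledSystem μ A B T x u w) (i : Fin N) (ω : Ω)
    {u' : ℕ → EuclideanSpace ℝ (Fin m)} {w' : ℕ → EuclideanSpace ℝ (Fin n)} {t : ℕ} (ht : t ≤ T)
    (hu : ∀ s < t, u' s = u i s ω) (hw : ∀ s < t, w' s = w i s ω) :
    x i t ω = trajectory A B u' w' t := by
  induction t with
  | zero => exact h.init i ω
  | succ t ih =>
    rw [h.dynamics i t ht ω, trajectory, hu t t.lt_succ_self, hw t t.lt_succ_self,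
      ← ih (by omega) (fun s hs => hu s (by omega)) (fun s hs => hw s (by omega))]

lemma IsSampledSystem.measurementRow_eq (h : IsSampledSystem μ A B T x u w) (hT : 1 ≤ T)
    (i : Fin N) (ω : Ω) {w' : ℕ → EuclideanSpace ℝ (Fin n)}
    (hw : ∀ s < T - 1, w' s = w i s ω) :
    measurementRow T x u i ω =
      stack (trajectory A B (extendZero fun t : Fin T => u i t ω) w' (T - 1))
        (extendZero (fun t : Fin T => u i t ω) (T - 1)) := by
  have hu : ∀ s < T, extendZero (fun t : Fin T => u i t ω) s = u i s ω := by
    intro s hs; simp [extendZero, hs]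
  rw [measurementRow, h.eq_trajectory i ω (t := T - 1) (by omega)
    (fun s hs => hu s (by omega)) hw, hu (T - 1) (by omega)]

lemma IsSampledSystem.measurementRow_eq' (h : IsSampledSystem μ A B T x u w) (hT : 1 ≤ T)
    (i : Fin N) (ω : Ω) :
    measurementRow T x u i ω =
      stack (trajectory A B (extendZero fun t : Fin T => u i t ω)
          (extendZero fun t : Fin T => w i t ω) (T - 1))
        (extendZero (fun t : Fin T => u i t ω) (T - 1)) :=
  h.measurementRow_eq hT i ω fun s hs => by
    simp [extendZero, show s < T by omega]

lemma IsSampledSystem.measurable_measurementRow (h : IsSampledSystem μ A B T x u w) (hT : 1 ≤ T)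
    (i : Fin N) : Measurable (measurementRow T x u i) := by
  have hu : Measurable fun ω (t : Fin T) => u i t ω :=
    measurable_pi_lambda _ fun t => h.measurable_input i t t.2
  have hw : Measurable fun ω (t : Fin T) => w i t ω :=
    measurable_pi_lambda _ fun t => h.measurable_noise i t t.2
  rw [funext (h.measurementRow_eq' hT i)]
  exact measurable_stack (measurable_trajectory A B (measurable_extendZero hu)
    (measurable_extendZero hw) _) (measurable_extendZero hu _)

lemma IsSampledSystem.iIndepFun_row_noise (h : IsSampledSystem μ A B T x u w) (hT : 1 ≤ T) :
    iIndepFun (fun i ω => (measurementRow T x u i ω, w i (T - 1) ω)) μ := by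
  have hfst : Measurable fun (p : Fin T → EuclideanSpace ℝ (Fin m) × EuclideanSpace ℝ (Fin n))
      (t : Fin T) => (p t).1 := by fun_prop
  have hsnd : Measurable fun (p : Fin T → EuclideanSpace ℝ (Fin m) × EuclideanSpace ℝ (Fin n))
      (t : Fin T) => (p t).2 := by fun_prop
  have := h.indep_samples.comp (fun _ p =>
    (stack (trajectory A B (extendZero fun t => (p t).1) (extendZero fun t => (p t).2) (T - 1))
      (extendZero (fun t => (p t).1) (T - 1)), (p ⟨T - 1, by omega⟩).2)) fun i =>
    (measurable_stack (measurable_trajectory A B (measurable_extendZero hfst)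
      (measurable_extendZero hsnd) _) (measurable_extendZero hfst _)).prodMk (by fun_prop)
  convert this using 2 with i
  ext1 ω
  simp [h.measurementRow_eq' hT i ω]

/-- The regressor is a function of the inputs and of the past noise only, hence independent of the
current noise. -/
lemma IsSampledSystem.indepFun_row_noise [IsProbabilityMeasure μ]
    (h : IsSampledSystem μ A B T x u w) (hT : 1 ≤ T) (i : Fin N) :
    IndepFun (measurementRow T x u i) (w i (T - 1)) μ := by
  classical
  have hu : Measurable fun ω (t : Fin T) => u i t ω :=
    measurable_pi_lambda _ fun t => h.measurable_input i t t.2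
  have hw : ∀ t : Fin T, Measurable fun ω => w i t ω := fun t => h.measurable_noise i t t.2
  let last : Fin T := ⟨T - 1, by omega⟩
  let past : Finset (Fin T) := Finset.univ.erase last
  have hpast : Measurable fun ω (t : past) => w i t ω := measurable_pi_lambda _ fun t => hw t
  have h1 : IndepFun (fun ω (t : past) => w i t ω) (fun ω => w i last ω) μ :=
    ((h.indep_noise i).indepFun_finset past {last} (by simp [past]) hw).comp measurable_id
      (measurable_pi_apply (⟨last, by simp⟩ : ({last} : Finset (Fin T))))
  have h2 : IndepFun (fun ω (t : Fin T) => u i t ω)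
      (fun ω => ((fun t : past => w i t ω), w i last ω)) μ :=
    (h.indep_input_noise i).comp measurable_id
      (ψ := fun p : Fin T → EuclideanSpace ℝ (Fin n) => ((fun t : past => p t), p last))
      (by fun_prop)
  have h3 := indepFun_prodMk_left hu hpast (hw last) h2 h1
  let G : (past → EuclideanSpace ℝ (Fin n)) → Fin T → EuclideanSpace ℝ (Fin n) :=
    fun q t => if ht : t ∈ past then q ⟨t, ht⟩ else 0
  have hG : Measurable G := measurable_pi_lambda _ fun t => by
    simp only [G]; split_ifs <;> fun_prop
  have h4 := h3.comp (φ := fun p => stack (trajectory A B (extendZero p.1) (extendZero (G p.2))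
      (T - 1)) (extendZero p.1 (T - 1)))
    (measurable_stack (measurable_trajectory A B (measurable_extendZero measurable_fst)
      (measurable_extendZero (hG.comp measurable_snd)) _)
      (measurable_extendZero measurable_fst _)) measurable_id
  refine h4.congr (Filter.EventuallyEq.of_eq ?_) Filter.EventuallyEq.rfl
  ext1 ω
  refine (h.measurementRow_eq hT i ω fun s hs => ?_).symm
  have hs1 : s < T := by omega
  have hs2 : (⟨s, hs1⟩ : Fin T) ∈ past := by
    simp only [past, last, Finset.mem_erase, Finset.mem_univ, and_true, ne_eq, Fin.mk.injEq]
    omega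
  simp [extendZero, hs1, G, hs2]

end Independence

/-! ### The error bound on the good event -/

section GoodEvent

variable {Ω : Type*} {n m N T : ℕ} {A : Matrix (Fin n) (Fin n) ℝ} {B : Matrix (Fin n) (Fin m) ℝ}
  {x : Fin N → ℕ → Ω → EuclideanSpace ℝ (Fin n)}
  {u : Fin N → ℕ → Ω → EuclideanSpace ℝ (Fin m)}
  {w : Fin N → ℕ → Ω → EuclideanSpace ℝ (Fin n)}

/-- The noise matrix, whose rows are the last noise vectors `w⁽ⁱ⁾(T-1)`. -/
def noiseMatrix (T : ℕ) (w : Fin N → ℕ → Ω → EuclideanSpace ℝ (Fin n)) (ω : Ω) :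
    Matrix (Fin N) (Fin n) ℝ :=
  Matrix.of fun i j => w i (T - 1) ω j

lemma toEuclideanLin_of_apply {ι κ : Type*} [Fintype ι] [Fintype κ] [DecidableEq κ]
    (a : ι → EuclideanSpace ℝ κ) (y : EuclideanSpace ℝ κ) (i : ι) :
    Matrix.toEuclideanLin (Matrix.of fun i j => a i j) y i = inner ℝ (a i) y := by
  simp [Matrix.toLpLin_apply, Matrix.mulVec, dotProduct, PiLp.inner_apply, mul_comm]

lemma inner_toEuclideanLin_of {ι κ ρ : Type*} [Fintype ι] [Fintype κ] [DecidableEq κ] [Fintype ρ]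
    [DecidableEq ρ] (a : ι → EuclideanSpace ℝ κ) (b : ι → EuclideanSpace ℝ ρ)
    (p : EuclideanSpace ℝ κ) (q : EuclideanSpace ℝ ρ) :
    inner ℝ (Matrix.toEuclideanLin (Matrix.of fun i j => a i j) p)
      (Matrix.toEuclideanLin (Matrix.of fun i j => b i j) q) =
      inner ℝ p (∑ i, (inner ℝ (b i) q : ℝ) • a i) := by
  rw [PiLp.inner_apply, inner_sum]
  refine Finset.sum_congr rfl fun i _ => ?_
  rw [toEuclideanLin_of_apply, toEuclideanLin_of_apply, real_inner_smul_right,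
    real_inner_comm p (a i)]
  simp

lemma IsSampledSystem.responseMatrix_eq [MeasurableSpace Ω] {μ : Measure Ω}
    (h : IsSampledSystem μ A B T x u w) (hT : 1 ≤ T) (ω : Ω) :
    responseMatrix T x ω =
      measurementMatrix T x u ω * paramMatrix A B + noiseMatrix T w ω := by
  ext i j
  have h1 := h.dynamics i (T - 1) (by omega) ω
  rw [Nat.sub_add_cancel hT] at h1
  simp only [responseMatrix, Matrix.of_apply, h1, Matrix.add_apply, noiseMatrix,
    Matrix.mul_apply, measurementMatrix, measurementRow, stack, paramMatrix,
    Matrix.transpose_apply, Fintype.sum_sum_type]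
  simp [Matrix.toLpLin_apply, Matrix.mulVec, dotProduct, mul_comm]

/-- Deterministic error bound, valid whenever the empirical covariance and the empirical
noise-regressor cross-covariance are close to their means. -/
lemma IsSampledSystem.solution_bound [MeasurableSpace Ω] {μ : Measure Ω}
    (h : IsSampledSystem μ A B T x u w)
    (hT : 1 ≤ T) (hN : 0 < N) {S : Matrix (Fin n ⊕ Fin m) (Fin n ⊕ Fin m) ℝ} {γ ρ : ℝ}
    (hγ : 0 < γ) (hρ : 0 ≤ ρ)
    (hS : ∀ v, γ * ‖v‖ ^ 2 ≤ inner ℝ v (Matrix.toEuclideanLin S v)) {ω : Ω}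
    (h1 : ∀ v, ‖(N : ℝ)⁻¹ • ∑ i, (inner ℝ (measurementRow T x u i ω) v : ℝ) •
      measurementRow T x u i ω - Matrix.toEuclideanLin S v‖ ≤ γ / 6 * ‖v‖)
    (h2 : ∀ v, ‖(N : ℝ)⁻¹ • ∑ i, (inner ℝ (w i (T - 1) ω) v : ℝ) •
      measurementRow T x u i ω‖ ≤ 6 * ρ * ‖v‖) :
    (∃ Θ, IsSolution (responseMatrix T x ω) (measurementMatrix T x u ω) (4 * ρ) Θ) ∧
      ∀ Θ, IsSolution (responseMatrix T x ω) (measurementMatrix T x u ω) (4 * ρ) Θ →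
        opNorm (Θ - paramMatrix A B) ≤ 12 * ρ / γ := by
  have hN' : (0 : ℝ) < N := by exact_mod_cast hN
  have hZ : ∀ v, 5 / 6 * γ * ‖v‖ ^ 2 ≤
      (N : ℝ)⁻¹ * ‖Matrix.toEuclideanLin (measurementMatrix T x u ω) v‖ ^ 2 := by
    intro v
    rw [← real_inner_self_eq_norm_sq (Matrix.toEuclideanLin _ v), measurementMatrix, inner_toEuclideanLin_of,
      ← real_inner_smul_right]
    have h3 := (abs_le.1 ((abs_real_inner_le_norm v _).trans
      (mul_le_mul_of_nonneg_left (h1 v) (norm_nonneg v)))).1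
    rw [inner_sub_right] at h3
    nlinarith [hS v]
  constructor
  · refine exists_isSolution hN _ _ (by positivity) (c := √(N * (5 / 6 * γ)))
      (Real.sqrt_pos.2 (by positivity)) fun v => ?_
    rw [← sq_le_sq₀ (by positivity) (norm_nonneg _), mul_pow, Real.sq_sqrt (by positivity)]
    have := hZ v
    rw [le_inv_mul_iff₀ hN'] at this
    linarith
  · intro Θ hΘ
    rw [h.responseMatrix_eq hT] at hΘ
    have h4 := hΘ.opNorm_sub_le hN (γ := 5 / 6 * γ) (ρ := 6 * ρ) (by positivity) (by positivity)
      (by positivity) hZ fun p q => by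
        rw [measurementMatrix, noiseMatrix, inner_toEuclideanLin_of, ← real_inner_smul_right]
        refine (real_inner_le_norm _ _).trans ?_
        nlinarith [h2 q, norm_nonneg p]
    refine h4.trans_eq ?_
    field_simp
    ring

end GoodEvent

/-! ### The probability of the good event -/

section Constants

/-- The union bound over two nets is absorbed by the exponential tail. -/
lemma nets_mul_exp_le {j k d : ℕ} (hj : j ≤ d) (hk : k ≤ d) {E : ℝ} (hE : 9 / 2 * (d : ℝ) ≤ E) :
    (5 : ℝ) ^ j * 5 ^ k * Real.exp (-E) ≤ Real.exp (-(d : ℝ)) := by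
  have h25 : (25 : ℝ) ≤ Real.exp (7 / 2) := by
    have h1 : Real.exp (7 / 2) ^ 2 = Real.exp 1 ^ 7 := by
      rw [← Real.exp_nat_mul, ← Real.exp_nat_mul]; norm_num
    have h2 : (2.7 : ℝ) ^ 7 ≤ Real.exp 1 ^ 7 :=
      pow_le_pow_left₀ (by norm_num) (by linarith [Real.exp_one_gt_d9]) 7
    refine le_of_sq_le_sq ?_ (Real.exp_pos _).le
    rw [h1]
    exact le_trans (by norm_num) h2
  calc (5 : ℝ) ^ j * 5 ^ k * Real.exp (-E)
      ≤ 5 ^ d * 5 ^ d * Real.exp (-(9 / 2 * (d : ℝ))) := by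
        gcongr <;> norm_num
    _ = 25 ^ d * Real.exp (-(9 / 2 * (d : ℝ))) := by rw [← mul_pow]; norm_num
    _ ≤ Real.exp (7 / 2) ^ d * Real.exp (-(9 / 2 * (d : ℝ))) := by gcongr
    _ = Real.exp (-(d : ℝ)) := by
        rw [← Real.exp_nat_mul, ← Real.exp_add]; congr 1; ring

lemma twelve_mul_le_of_sq_eq {α σ β γ : ℝ} (hα : 0 ≤ α) (hγ : 0 ≤ γ)
    (h : α ^ 2 = 2 * σ ^ 2 * ((32 * √6 + 1) * β ^ 2 + γ)) : 12 * (β * σ) ≤ α := by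
  have h6 : (2.4 : ℝ) ≤ √6 := Real.le_sqrt_of_sq_le (by norm_num)
  refine le_of_sq_le_sq ?_ hα
  rw [h]
  have h1 : 0 ≤ σ ^ 2 * β ^ 2 * (√6 - 2.4) := mul_nonneg (by positivity) (by linarith)
  have h2 : 0 ≤ σ ^ 2 * γ := by positivity
  nlinarith [sq_nonneg (σ * β)]

end Constants

section Probability

variable {Ω : Type*} [MeasurableSpace Ω] {μ : Measure Ω} [IsProbabilityMeasure μ] {n m N T : ℕ}
  {A : Matrix (Fin n) (Fin n) ℝ} {B : Matrix (Fin n) (Fin m) ℝ}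
  {x : Fin N → ℕ → Ω → EuclideanSpace ℝ (Fin n)}
  {u : Fin N → ℕ → Ω → EuclideanSpace ℝ (Fin m)}
  {w : Fin N → ℕ → Ω → EuclideanSpace ℝ (Fin n)}

/-- Both deviations entering the deterministic error bound are small outside an event of
exponentially small probability. -/
lemma IsSampledSystem.measure_not_solution_bound_le (hsys : IsSampledSystem μ A B T x u w)
    (hT : 1 ≤ T) (hn : 0 < n) {σ β : ℝ} (hw : ∀ i, ∀ t < T, IsSubGaussianVec (w i t) σ μ)
    (hz : ∀ i, IsSubGaussianVec (measurementRow T x u i) β μ)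
    {S : Matrix (Fin n ⊕ Fin m) (Fin n ⊕ Fin m) ℝ}
    (hS : ∀ i, covMatrix (measurementRow T x u i) μ = S) (hγ : 0 < gammaMin S)
    {α : ℝ} (hα : 0 ≤ α)
    (hα2 : α ^ 2 = 2 * σ ^ 2 * ((32 * √6 + 1) * β ^ 2 + gammaMax S)) (hN : 0 < N)
    (hNc : 186624 * β ^ 4 / gammaMin S ^ 2 * ((n : ℝ) + m) ≤ N)
    {lam : ℝ} (hlam : lam = 4 * α * √(((n : ℝ) + m) / N)) :
    μ {ω | ¬ ((∃ Θ, IsSolution (responseMatrix T x ω) (measurementMatrix T x u ω) lam Θ) ∧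
          ∀ Θ, IsSolution (responseMatrix T x ω) (measurementMatrix T x u ω) lam Θ →
            opNorm (Θ - paramMatrix A B) ≤
              12 * α / gammaMin S * √(((n : ℝ) + m) / N))} ≤
      ENNReal.ofReal (2 * Real.exp (-1 * ((n : ℝ) + m))) := by
  have hN' : (0 : ℝ) < N := by exact_mod_cast hN
  have hβ : 0 < β := (hz ⟨0, hN⟩).param_pos
  have hσ : 0 < σ := (hw ⟨0, hN⟩ 0 (by omega)).param_pos
  set γ := gammaMin S with hγdef
  set d : ℝ := (n : ℝ) + m with hd
  have hd0 : 0 ≤ d := by positivity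
  have hdcast : ((n + m : ℕ) : ℝ) = d := by push_cast; rfl
  set s := √(d / N) with hs
  have hs2 : s ^ 2 = d / N := Real.sq_sqrt (by positivity)
  have hs0 : 0 ≤ s := Real.sqrt_nonneg _
  have hSform : ∀ v, γ * ‖v‖ ^ 2 ≤ inner ℝ v (Matrix.toEuclideanLin S v) := by
    rw [hγdef, ← hS ⟨0, hN⟩]
    exact (hz ⟨0, hN⟩).gammaMin_mul_norm_sq_le
  have hγβ : γ ≤ 8 / 3 * β ^ 2 := by
    have h1 := hSform (EuclideanSpace.single (Sum.inl ⟨0, hn⟩) 1)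
    rw [← hS ⟨0, hN⟩] at h1
    have h2 := h1.trans ((hz ⟨0, hN⟩).inner_covMatrix_le (by simp))
    simpa using h2
  -- the lower bound on the number of samples, without denominators
  have hNc' : 186624 * β ^ 4 * d ≤ N * γ ^ 2 := by
    rw [div_mul_eq_mul_div, div_le_iff₀ (by positivity)] at hNc
    exact hNc
  have hα12 := twelve_mul_le_of_sq_eq hα (LinearMap.singularValues_nonneg _ _) hα2
  -- `t₁` makes the deviation of the empirical covariance equal to `γ / 6`
  set t₁ := γ / (24 * β ^ 2) with ht₁
  have ht₁0 : 0 ≤ t₁ := by positivity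
  have ht₁le : t₁ ≤ 9 / 2 := by
    rw [ht₁, div_le_iff₀ (by positivity)]; nlinarith [sq_nonneg β]
  have hexp₁ : 9 / 2 * ((n + m : ℕ) : ℝ) ≤ N * t₁ ^ 2 / 72 := by
    rw [hdcast, ht₁, div_pow, mul_pow, mul_div_assoc', div_div, le_div_iff₀ (by positivity)]
    calc 9 / 2 * d * ((24 ^ 2 * (β ^ 2) ^ 2) * 72) = 186624 * β ^ 4 * d := by ring
      _ ≤ N * γ ^ 2 := hNc'
  have hs4 : s ≤ 1 / 4 := by
    refine le_of_sq_le_sq ?_ (by norm_num)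
    rw [hs2, div_le_iff₀ hN']
    have h1 : γ ^ 2 ≤ (8 / 3 * β ^ 2) ^ 2 := pow_le_pow_left₀ hγ.le hγβ 2
    have h2 : 186624 * β ^ 4 * d ≤ N * (8 / 3 * β ^ 2) ^ 2 :=
      hNc'.trans (by gcongr)
    have h3 : β ^ 4 * (186624 * d) ≤ β ^ 4 * (64 / 9 * N) := by linarith
    have := le_of_mul_le_mul_left h3 (by positivity)
    linarith
  -- `t₂` makes the deviation of the noise term at most `6 α √(d / N)`
  set t₂ := 18 * s with ht₂
  have hexp₂ : 9 / 2 * ((n + m : ℕ) : ℝ) ≤ N * t₂ ^ 2 / 72 := by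
    rw [hdcast, ht₂, mul_pow, hs2]
    apply le_of_eq; field_simp; ring
  have hzm := hsys.measurable_measurementRow hT
  have hwm : ∀ i, Measurable (w i (T - 1)) := fun i => hsys.measurable_noise i _ (by omega)
  have hwg : ∀ i, IsSubGaussianVec (w i (T - 1)) σ μ := fun i => hw i _ (by omega)
  have hind := hsys.iIndepFun_row_noise hT
  have hB₁ := measure_not_norm_sum_sub_le hN hβ hβ hz hz hzm hzm
    (hind.comp (fun _ p => (p.1, p.1)) fun i => by fun_prop) (Matrix.toEuclideanLin S)
    (fun i v y => by rw [(hz i).integral_inner_mul_inner, hS i]) ht₁0 ht₁le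
  have hB₂ := measure_not_norm_sum_sub_le hN hβ hσ hz hwg hzm hwm hind 0
    (fun i v y => by
      have h1 := ((hsys.indepFun_row_noise hT i).comp (φ := fun z => inner ℝ v z)
        (ψ := fun z => inner ℝ y z) (by fun_prop) (by fun_prop)).integral_mul_eq_mul_integral
        (Measurable.aestronglyMeasurable (by have := hzm i; fun_prop))
        (Measurable.aestronglyMeasurable (by have := hwm i; fun_prop))
      have h2 := (hwg i).integral_inner_eq_zero y
      simp only [Function.comp_def, Pi.mul_apply] at h1
      rw [h1, h2]; simp) (by positivity : 0 ≤ t₂) (by linarith : t₂ ≤ 9 / 2)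
  have hle₁ := hB₁.trans (ENNReal.ofReal_le_ofReal
    (nets_mul_exp_le (d := n + m) (by simp) (by simp) hexp₁))
  have hle₂ := hB₂.trans (ENNReal.ofReal_le_ofReal
    (nets_mul_exp_le (d := n + m) (by simp) (by simp) hexp₂))
  rw [show 2 * Real.exp (-1 * d) = Real.exp (-((n + m : ℕ) : ℝ)) + Real.exp (-((n + m : ℕ) : ℝ)) by
    rw [hdcast]; ring_nf, ENNReal.ofReal_add (Real.exp_pos _).le (Real.exp_pos _).le]
  refine le_trans (measure_mono ?_) ((measure_union_le _ _).trans (add_le_add hle₁ hle₂))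
  intro ω hω
  by_contra hout
  simp only [Set.mem_union, Set.mem_ofPred_eq, not_or, not_not] at hout
  refine hω ?_
  have hfinal := hsys.solution_bound hT hN hγ (mul_nonneg hα hs0) hSform (ω := ω)
    (fun v => (hout.1 v).trans_eq (by rw [ht₁]; field_simp; ring)) (fun v => by
      have h1 := hout.2 v
      rw [LinearMap.zero_apply, sub_zero] at h1
      refine h1.trans ?_
      refine mul_le_mul_of_nonneg_right ?_ (norm_nonneg v)
      rw [ht₂]
      nlinarith)
  rw [← mul_assoc 4, ← hlam] at hfinal
  refine ⟨hfinal.1, fun Θ hΘ => (hfinal.2 Θ hΘ).trans_eq ?_⟩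
  ring

end Probability

end VARX

theorem corollary2 :
    ∃ c₁ c₅ c₆ : ℝ, 0 < c₁ ∧ 0 < c₅ ∧ 0 < c₆ ∧
      ∀ {Ω : Type*} [MeasurableSpace Ω] (μ : Measure Ω) [IsProbabilityMeasure μ]
        (n m N T r : ℕ) (_ : 1 ≤ T)
        (A : Matrix (Fin n) (Fin n) ℝ) (B : Matrix (Fin n) (Fin m) ℝ)
        (x : Fin N → ℕ → Ω → EuclideanSpace ℝ (Fin n))
        (u : Fin N → ℕ → Ω → EuclideanSpace ℝ (Fin m))
        (w : Fin N → ℕ → Ω → EuclideanSpace ℝ (Fin n))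
        (_ : VARX.IsSampledSystem μ A B T x u w)
        (_ : (VARX.paramMatrix A B).rank = r) (_ : r < n)
        (σw : ℝ) (_ : ∀ i, ∀ t < T, VARX.IsSubGaussianVec (w i t) σw μ)
        (β : ℝ) (_ : ∀ i, VARX.IsSubGaussianVec (VARX.measurementRow T x u i) β μ)
        (S : Matrix (Fin n ⊕ Fin m) (Fin n ⊕ Fin m) ℝ)
        (_ : ∀ i, VARX.covMatrix (VARX.measurementRow T x u i) μ = S)
        (_ : 0 < VARX.gammaMin S)
        (α : ℝ) (_ : 0 ≤ α)
        (_ : α ^ 2 = 2 * σw ^ 2 * ((32 * Real.sqrt 6 + 1) * β ^ 2 + VARX.gammaMax S))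
        (_ : 0 < N)
        (_ : c₁ * β ^ 4 / VARX.gammaMin S ^ 2 * ((n : ℝ) + m) ≤ N)
        (lam : ℝ) (_ : lam = 4 * α * Real.sqrt (((n : ℝ) + m) / N)),
        μ {ω | ¬ ((∃ Θ, VARX.IsSolution (VARX.responseMatrix T x ω)
                    (VARX.measurementMatrix T x u ω) lam Θ) ∧
                  ∀ Θ, VARX.IsSolution (VARX.responseMatrix T x ω)
                    (VARX.measurementMatrix T x u ω) lam Θ →
                    VARX.opNorm (Θ - VARX.paramMatrix A B) ≤
                      12 * α / VARX.gammaMin S * Real.sqrt (((n : ℝ) + m) / N))} ≤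
          ENNReal.ofReal (c₅ * Real.exp (-c₆ * ((n : ℝ) + m))) := by
  -- `186624 = (9 / 2) * 24 ^ 2 * 72` makes the exponent of the covariance deviation `9 d / 2`
  refine ⟨186624, 2, 1, by norm_num, by norm_num, by norm_num, ?_⟩
  intro Ω _ μ _ n m N T r hT A B x u w hsys _ hr σ hw β hz S hS hγ α hα hα2 hN hNc lam hlam
  exact hsys.measure_not_solution_bound_le hT (by omega) hw hz hS hγ hα hα2 hN hNc hlam
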